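/- There are universal constants $c, C > 0$ with the following property. Let $n, d, T, N$ be positive integers with $T \ge 2$, $d \le n/2$ and $d(n-d) > C$, and let $\sigma_w > 0$, $\sigma_u \ge 0$ satisfy $TN \ge \frac{\sigma_w^2}{\sigma_w^2+\sigma_u^2}(n-d)$. For $\rho \in (0,1)$ let $$\mathscr{G}(\rho, d) := \{ (\rho UU^{\mathsf T}, \rho U) : U \in \mathbb{R}^{n\times d},\ U^{\mathsf T}U = I_d \}.$$ For $(A_\star, B_\star) \in \mathscr{G}(\rho,d)$ consider the system $x_{t+1} = A_\star x_t + B_\star u_t + w_t$, $x_0 = 0$, with $w_t$ i.i.d. $\mathcal N(0,\sigma_w^2 I_n)$; let $J(K)$ be the expected cost $\mathbb{E}[\sum_{t=0}^T \|x_t\|_2^2]$ of the feedback $u_t = K x_t$, and let $J_\star$ be the minimum of this expected cost over all causal policies. An algorithm $\mathcal{A}$ chooses, for $i=1,\dots,N$, a matrix $K_i \in \mathbb{R}^{d\times n}$ of operator norm $\|K_i\| \le 1$, possibly at random and depending on the previous gains and rollouts, and then observes the states and inputs of an independent rollout of $T$ steps with $u_t = K_i x_t + \eta_t$, $\eta_t$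 i.i.d. $\mathcal N(0,\sigma_u^2 I_d)$; after the $N$ rollouts it returns a matrix $\widehat K \in \mathbb{R}^{d\times n}$, possibly at random and depending on all that it has seen. Then $$ \inf_{\mathcal{A}} \ \sup_{\rho \in (0,1/4),\ (A_\star,B_\star) \in \mathscr{G}(\rho,d)} \mathbb{E}\big[ J(\widehat K) - J_\star \big] \ \ge\ c\, \frac{\sigma_w^4}{\sigma_w^2+\sigma_u^2}\, \frac{d(n-d)}{N}. $$ -/

import Mathlib

open MeasureTheory ProbabilityTheory Matrix
open scoped NNReal ENNReal

noncomputable section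

namespace LQR

/-- Real matrices carry the product (Borel) σ-algebra of their entries. -/
instance instMeasurableSpaceMatrix {m n : ℕ} : MeasurableSpace (Matrix (Fin m) (Fin n) ℝ) :=
  inferInstanceAs (MeasurableSpace (Fin m → Fin n → ℝ))

/-! ### Measurability facts used by the definitions -/

theorem measurable_snoc {X : Type*} [MeasurableSpace X] (t : ℕ) :
    Measurable (fun p : (Fin t → X) × X => (Fin.snoc (α := fun _ => X) p.1 p.2 : Fin (t + 1) → X)) := by
  refine measurable_pi_lambda _ (fun i => ?_)
  refine Fin.lastCases ?_ (fun j => ?_) i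
  · simpa using measurable_snd
  · simp only [Fin.snoc_castSucc]
    exact (measurable_pi_apply j).comp measurable_fst

theorem measurable_mulVec_prod {m n : ℕ} {α : Type*} [MeasurableSpace α]
    {M : α → Matrix (Fin m) (Fin n) ℝ} {x : α → Fin n → ℝ}
    (hM : Measurable M) (hx : Measurable x) : Measurable (fun a => M a *ᵥ x a) := by
  refine measurable_pi_lambda _ (fun i => ?_)
  simp only [Matrix.mulVec, dotProduct]
  refine Finset.measurable_sum _ (fun j _ => ?_)
  have h1 : Measurable (fun a => M a i j) :=
    (measurable_pi_apply j).comp ((measurable_pi_apply i).comp hM)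
  exact h1.mul ((measurable_pi_apply j).comp hx)

/-! ### Gaussian noise -/

/-- The law `N(0, σ² I_k)`: independent centered Gaussian coordinates of variance `σ²`. -/
def isoGaussian (k : ℕ) (σ : ℝ≥0) : Measure (Fin k → ℝ) :=
  Measure.pi (fun _ => gaussianReal 0 (σ ^ 2))

instance (k : ℕ) (σ : ℝ≥0) : IsProbabilityMeasure (isoGaussian k σ) := by
  unfold isoGaussian; infer_instance

/-- The kernel sending `a` to the law of `f a + ξ` with `ξ ∼ N(0, σ² I_k)`. -/
def gaussianKernel {α : Type*} [MeasurableSpace α] {k : ℕ} (f : α → Fin k → ℝ)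
    (hf : Measurable f) (σ : ℝ≥0) : Kernel α (Fin k → ℝ) :=
  (Kernel.deterministic f hf ×ₖ Kernel.const α (isoGaussian k σ)).map (fun p => p.1 + p.2)

instance {α : Type*} [MeasurableSpace α] {k : ℕ} (f : α → Fin k → ℝ)
    (hf : Measurable f) (σ : ℝ≥0) : IsMarkovKernel (gaussianKernel f hf σ) := by
  unfold gaussianKernel
  exact Kernel.IsMarkovKernel.map _ (measurable_fst.add measurable_snd)

/-! ### The linear system and its trajectories -/

/-- A trajectory with `t` transitions started at `x_0 = 0`: the entry `s` is `(u_s, x_{s+1})`. -/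
abbrev Traj (n d t : ℕ) : Type := Fin t → (Fin d → ℝ) × (Fin n → ℝ)

/-- The last state `x_t` of a trajectory with `t` transitions; `x_0 = 0`. -/
def curState {n d : ℕ} : (t : ℕ) → Traj n d t → (Fin n → ℝ)
  | 0, _ => 0
  | t + 1, h => (h (Fin.last t)).2

theorem measurable_curState {n d : ℕ} (t : ℕ) : Measurable (curState (n := n) (d := d) t) := by
  cases t with
  | zero => exact measurable_const
  | succ t => exact measurable_snd.comp (measurable_pi_apply _)

theorem measurable_drift {n d : ℕ} (A : Matrix (Fin n) (Fin n) ℝ) (B : Matrix (Fin n) (Fin d) ℝ) :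
    Measurable (fun p : (Fin n → ℝ) × (Fin d → ℝ) => A *ᵥ p.1 + B *ᵥ p.2) :=
  (measurable_mulVec_prod measurable_const measurable_fst).add
    (measurable_mulVec_prod measurable_const measurable_snd)

/-- One step of the system: `(x, u)` is sent to the law of `A x + B u + w`, `w ∼ N(0, σw² I_n)`. -/
def dynamics {n d : ℕ} (A : Matrix (Fin n) (Fin n) ℝ) (B : Matrix (Fin n) (Fin d) ℝ) (σw : ℝ≥0) :
    Kernel ((Fin n → ℝ) × (Fin d → ℝ)) (Fin n → ℝ) :=
  gaussianKernel (fun p => A *ᵥ p.1 + B *ᵥ p.2) (measurable_drift A B) σw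

instance {n d : ℕ} (A : Matrix (Fin n) (Fin n) ℝ) (B : Matrix (Fin n) (Fin d) ℝ) (σw : ℝ≥0) :
    IsMarkovKernel (dynamics A B σw) := by
  unfold dynamics; infer_instance

/-- A family of causal policies indexed by `Θ`: the law of `u_t` given the parameter and the
trajectory up to `x_t`. -/
abbrev Policy (Θ : Type) [MeasurableSpace Θ] (n d : ℕ) : Type :=
  (t : ℕ) → Kernel (Θ × Traj n d t) (Fin d → ℝ)

/-- The law of the first `t` transitions of the closed loop, given the policy parameter:
at every step `u_t` is drawn from the policy and then `x_{t+1}` from the dynamics at `(x_t, u_t)`. -/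
def trajLaw {Θ : Type} [MeasurableSpace Θ] {n d : ℕ} (A : Matrix (Fin n) (Fin n) ℝ)
    (B : Matrix (Fin n) (Fin d) ℝ) (σw : ℝ≥0) (π : Policy Θ n d) : (t : ℕ) → Kernel Θ (Traj n d t)
  | 0 => Kernel.const Θ (Measure.dirac (fun i => i.elim0))
  | t + 1 =>
    (trajLaw A B σw π t ⊗ₖ
      (π t ⊗ₖ (dynamics A B σw).comap
        (fun p : (Θ × Traj n d t) × (Fin d → ℝ) => (curState t p.1.2, p.2))
        (((measurable_curState t).comp (measurable_snd.comp measurable_fst)).prodMk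
          measurable_snd))).map
      (fun p => Fin.snoc (α := fun _ => (Fin d → ℝ) × (Fin n → ℝ)) p.1 p.2)

instance {Θ : Type} [MeasurableSpace Θ] {n d : ℕ} (A : Matrix (Fin n) (Fin n) ℝ)
    (B : Matrix (Fin n) (Fin d) ℝ) (σw : ℝ≥0) (π : Policy Θ n d) [∀ t, IsMarkovKernel (π t)]
    (t : ℕ) : IsMarkovKernel (trajLaw A B σw π t) := by
  induction t with
  | zero => unfold trajLaw; infer_instance
  | succ t ih => unfold trajLaw; exact Kernel.IsMarkovKernel.map _ (measurable_snoc t)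

/-! ### Policies, costs -/

theorem measurable_feedback {n d : ℕ} (t : ℕ) :
    Measurable (fun p : Matrix (Fin d) (Fin n) ℝ × Traj n d t => p.1 *ᵥ curState t p.2) :=
  measurable_mulVec_prod measurable_fst ((measurable_curState t).comp measurable_snd)

/-- The policies `u_t = K x_t + η_t`, `η_t ∼ N(0, σu² I_d)`, indexed by the gain `K`. -/
def noisyFeedback (n d : ℕ) (σu : ℝ≥0) : Policy (Matrix (Fin d) (Fin n) ℝ) n d :=
  fun t => gaussianKernel (fun p => p.1 *ᵥ curState t p.2) (measurable_feedback t) σu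

/-- The noiseless policies `u_t = K x_t`, indexed by the gain `K`. -/
def feedback (n d : ℕ) : Policy (Matrix (Fin d) (Fin n) ℝ) n d :=
  fun t => Kernel.deterministic (fun p => p.1 *ᵥ curState t p.2) (measurable_feedback t)

/-- The policy `u_t = φ_t(u_0, x_1, …, u_{t-1}, x_t)` for measurable functions `φ_t` of the past. -/
def ofFun {n d : ℕ} (φ : (t : ℕ) → Traj n d t → (Fin d → ℝ)) (hφ : ∀ t, Measurable (φ t)) :
    Policy Unit n d :=
  fun t => Kernel.deterministic (fun p => φ t p.2) ((hφ t).comp measurable_snd)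

instance (n d : ℕ) (σu : ℝ≥0) (t : ℕ) : IsMarkovKernel (noisyFeedback n d σu t) := by
  unfold noisyFeedback; infer_instance

instance (n d t : ℕ) : IsMarkovKernel (feedback n d t) := by
  unfold feedback; infer_instance

instance {n d : ℕ} (φ : (t : ℕ) → Traj n d t → (Fin d → ℝ)) (hφ : ∀ t, Measurable (φ t)) (t : ℕ) :
    IsMarkovKernel (ofFun φ hφ t) := by
  unfold ofFun; infer_instance

/-- `‖x_0‖² + ‖x_1‖² + … + ‖x_T‖²` along a trajectory (recall that `x_0 = 0`). -/
def pathCost {n d T : ℕ} (h : Traj n d T) : ℝ := ∑ t, (h t).2 ⬝ᵥ (h t).2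

/-- The expected cost `J(K) = E[∑_{t ≤ T} ‖x_t‖²]` of the noiseless static feedback `u_t = K x_t`. -/
def gainCost {n d : ℕ} (A : Matrix (Fin n) (Fin n) ℝ) (B : Matrix (Fin n) (Fin d) ℝ) (σw : ℝ≥0)
    (T : ℕ) (K : Matrix (Fin d) (Fin n) ℝ) : ℝ≥0∞ :=
  ∫⁻ h, ENNReal.ofReal (pathCost h) ∂(trajLaw A B σw (feedback n d) T K)

/-- The optimal expected cost `J_⋆` over all causal policies `u_t(·)`. -/
def optCost {n d : ℕ} (A : Matrix (Fin n) (Fin n) ℝ) (B : Matrix (Fin n) (Fin d) ℝ) (σw : ℝ≥0)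
    (T : ℕ) : ℝ≥0∞ :=
  ⨅ (φ : (t : ℕ) → Traj n d t → (Fin d → ℝ)) (hφ : ∀ t, Measurable (φ t)),
    ∫⁻ h, ENNReal.ofReal (pathCost h) ∂(trajLaw A B σw (ofFun φ hφ) T ())

/-! ### Adaptive algorithms and their risk -/

/-- What an algorithm has seen after `i` rollouts: the gains that it played and the trajectories. -/
abbrev Record (n d T i : ℕ) : Type := Fin i → Matrix (Fin d) (Fin n) ℝ × Traj n d T

open scoped Matrix.Norms.L2Operator in
/-- A (possibly adaptive, possibly randomized) algorithm for `N` rollouts of horizon `T`: before the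
rollout `i` it picks a gain of operator norm at most `1` from its record, and after `N` rollouts
it returns an arbitrary gain. (Only `gain i` with `i < N` is ever used.) -/
structure Algorithm (n d T N : ℕ) where
  /-- the law of the next gain given the record -/
  gain : (i : ℕ) → Kernel (Record n d T i) (Matrix (Fin d) (Fin n) ℝ)
  /-- the law of the returned gain given the record -/
  output : Kernel (Record n d T N) (Matrix (Fin d) (Fin n) ℝ)
  gain_markov : ∀ i, IsMarkovKernel (gain i)
  output_markov : IsMarkovKernel output
  norm_gain_le : ∀ i r, ∀ᵐ K ∂(gain i r), ‖K‖ ≤ 1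

/-- The law of the record after `i` rollouts on the system `(A, B)`. -/
def recordLaw {n d T N : ℕ} (𝒜 : Algorithm n d T N) (A : Matrix (Fin n) (Fin n) ℝ)
    (B : Matrix (Fin n) (Fin d) ℝ) (σw σu : ℝ≥0) : (i : ℕ) → Measure (Record n d T i)
  | 0 => Measure.dirac (fun i => i.elim0)
  | i + 1 =>
    (recordLaw 𝒜 A B σw σu i ⊗ₘ
      (𝒜.gain i ⊗ₖ (trajLaw A B σw (noisyFeedback n d σu) T).comap
        (fun p : Record n d T i × Matrix (Fin d) (Fin n) ℝ => p.2) measurable_snd)).map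
      (fun p => Fin.snoc (α := fun _ => Matrix (Fin d) (Fin n) ℝ × Traj n d T) p.1 p.2)

instance {n d T N : ℕ} (𝒜 : Algorithm n d T N) (A : Matrix (Fin n) (Fin n) ℝ)
    (B : Matrix (Fin n) (Fin d) ℝ) (σw σu : ℝ≥0) (i : ℕ) :
    IsProbabilityMeasure (recordLaw 𝒜 A B σw σu i) := by
  have := 𝒜.gain_markov
  induction i with
  | zero => unfold recordLaw; infer_instance
  | succ i ih =>
    unfold recordLaw
    exact Measure.isProbabilityMeasure_map (measurable_snoc i).aemeasurable

/-- The risk `E[J(K̂) - J_⋆]` of the returned gain. The subtraction in `[0, ∞]` does not truncate: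
`J_⋆` is finite, and `J_⋆ ≤ J(K)` for every gain `K`, as static feedback is a causal policy. -/
def risk {n d T N : ℕ} (𝒜 : Algorithm n d T N) (A : Matrix (Fin n) (Fin n) ℝ)
    (B : Matrix (Fin n) (Fin d) ℝ) (σw σu : ℝ≥0) : ℝ≥0∞ :=
  ∫⁻ r, ∫⁻ K, (gainCost A B σw T K - optCost A B σw T) ∂(𝒜.output r) ∂(recordLaw 𝒜 A B σw σu N)

/-- The instances `(A, B) = (ρ U Uᵀ, ρ U)` with `U ∈ ℝ^{n × d}`, `Uᵀ U = I_d`. -/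
def instanceFamily (n d : ℕ) (ρ : ℝ) : Set (Matrix (Fin n) (Fin n) ℝ × Matrix (Fin n) (Fin d) ℝ) :=
  {P | ∃ U : Matrix (Fin n) (Fin d) ℝ, Uᵀ * U = 1 ∧ P = (ρ • (U * Uᵀ), ρ • U)}

end LQR

end

namespace LQR

/-! Put `W = Uᵀ`. The gain `-W` cancels the drift, so the optimal cost is at most that of pure
noise. For any `K` each transition except the first pays at least `σw² ‖A + BK‖²` on top of this in
Frobenius norm, and that norm equals `ρ ‖K + W‖` because `Wᵀ` is an isometry
(`le_gainCost_sub_optCost_instance`). It remains to show that `W` cannot be estimated to small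
constant squared error per row when `ρ² ≈ (n-d) σw² / (N T (σw² + σu²))`; multiplying that error by
`T σw² ρ² d` gives the rate.

The rows of `W` are the first `d` rows of a Haar-random orthogonal `O`. In the orthonormal basis of
all rows of `O`, the error of row `k` splits into planes spanned by row `k` and one of the `m = n-d`
rows outside `W` (`sum_planeLoss_le`). A reflection `H` in one such plane moves row `k` by squared
length at most `2/m` and leaves the other rows of `W` alone. No vector has small plane loss for both
`O` and `H * O` (`le_planeLoss_add_planeLoss`), and Haar measure is invariant under `O ↦ H * O`. A
two-point bound for the pair therefore bounds the average loss in every plane, and the losses of the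
`d m` planes add up.

The two-point bound (`le_lintegral_add_lintegral_recordLaw`) uses the likelihood ratio of the two
records. Gains and inputs are drawn in the same way under both systems, so only the Gaussian
transitions contribute. The log-ratio is `M - V/2` with `M` a martingale and `V` its conditional
variance, and both `E M²` and `E V` are at most `N T` times a bound on one step. That bound
(`meanStepVariance_instance_le`) comes from stability: for `‖K‖ ≤ 1` and `ρ ≤ 1/4` the state has
second moment at most `2 (σw² + σu²)` in every unit direction. -/

theorem measurable_dotProduct {α : Type*} [MeasurableSpace α] {k : ℕ} {f g : α → Fin k → ℝ}
    (hf : Measurable f) (hg : Measurable g) : Measurable (fun a => f a ⬝ᵥ g a) := by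
  unfold dotProduct
  exact Finset.measurable_sum _ fun i _ =>
    ((measurable_pi_apply i).comp hf).mul ((measurable_pi_apply i).comp hg)

theorem dotProduct_self_nonneg {k : ℕ} (b : Fin k → ℝ) : 0 ≤ b ⬝ᵥ b :=
  Finset.sum_nonneg fun i _ => mul_self_nonneg (b i)

/-! ### Moments and translates of isotropic Gaussians. -/

theorem memLp_eval_isoGaussian (k : ℕ) (σ : ℝ≥0) (i : Fin k) (b : ℝ) :
    MemLp (fun w : Fin k → ℝ => b * w i) 2 (isoGaussian k σ) := by
  have h : MemLp (fun x : ℝ => b * x) 2 (gaussianReal 0 (σ ^ 2)) :=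
    (memLp_id_gaussianReal' 2 (by simp)).const_mul b
  exact h.comp_measurePreserving (measurePreserving_eval (fun _ : Fin k => gaussianReal 0 (σ ^ 2)) i)

theorem memLp_dotProduct_isoGaussian (k : ℕ) (σ : ℝ≥0) (b : Fin k → ℝ) :
    MemLp (fun w : Fin k → ℝ => b ⬝ᵥ w) 2 (isoGaussian k σ) := by
  unfold dotProduct
  exact memLp_finsetSum _ fun i _ => memLp_eval_isoGaussian k σ i (b i)

theorem integral_dotProduct_isoGaussian (k : ℕ) (σ : ℝ≥0) (b : Fin k → ℝ) :
    ∫ w, b ⬝ᵥ w ∂isoGaussian k σ = 0 := by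
  unfold dotProduct
  rw [integral_finsetSum _ fun i _ => (memLp_eval_isoGaussian k σ i (b i)).integrable (by norm_num)]
  refine Finset.sum_eq_zero fun i _ => ?_
  rw [integral_const_mul]
  have : ∫ w : Fin k → ℝ, w i ∂isoGaussian k σ = ∫ x, x ∂gaussianReal 0 (σ ^ 2) := by
    have h := integral_map (μ := isoGaussian k σ) (φ := Function.eval i) (f := fun x : ℝ => x)
      (measurable_pi_apply i).aemeasurable (by fun_prop)
    rw [← (measurePreserving_eval (fun _ : Fin k => gaussianReal 0 (σ ^ 2)) i).map_eq]
    exact h.symm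
  rw [this, integral_id_gaussianReal, mul_zero]

theorem variance_dotProduct_isoGaussian (k : ℕ) (σ : ℝ≥0) (b : Fin k → ℝ) :
    Var[fun w => b ⬝ᵥ w; isoGaussian k σ] = σ ^ 2 * (b ⬝ᵥ b) := by
  have h := variance_sum_pi (μ := fun _ : Fin k => gaussianReal 0 (σ ^ 2))
    (X := fun i x => b i * x) fun i => (memLp_id_gaussianReal' 2 (by simp)).const_mul (b i)
  have e : (∑ i, fun w : Fin k → ℝ => b i * w i) = fun w => b ⬝ᵥ w := by
    ext w; simp [dotProduct]
  rw [e] at h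
  unfold isoGaussian
  rw [h, dotProduct, Finset.mul_sum]
  refine Finset.sum_congr rfl fun i _ => ?_
  rw [variance_const_mul, variance_fun_id_gaussianReal]
  push_cast
  ring

theorem integral_sq_isoGaussian (k : ℕ) (σ : ℝ≥0) (a : ℝ) (b : Fin k → ℝ) :
    ∫ w, (a + b ⬝ᵥ w) ^ 2 ∂isoGaussian k σ = a ^ 2 + σ ^ 2 * (b ⬝ᵥ b) := by
  have hL := memLp_dotProduct_isoGaussian k σ b
  have h1 : Integrable (fun w => b ⬝ᵥ w) (isoGaussian k σ) := hL.integrable (by norm_num)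
  have hv := variance_dotProduct_isoGaussian k σ b
  rw [variance_of_integral_eq_zero hL.aemeasurable (integral_dotProduct_isoGaussian k σ b)] at hv
  have e : (fun w : Fin k → ℝ => (a + b ⬝ᵥ w) ^ 2)
      = fun w => (a ^ 2 + (2 * a) * (b ⬝ᵥ w)) + (b ⬝ᵥ w) ^ 2 := by
    ext w; ring
  rw [e, integral_add (f := fun w => a ^ 2 + (2 * a) * (b ⬝ᵥ w))
    ((integrable_const _).add (h1.const_mul _)) hL.integrable_sq, integral_add (integrable_const _) (h1.const_mul _), integral_const_mul,
    integral_dotProduct_isoGaussian, hv]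
  simp

theorem lintegral_sq_isoGaussian (k : ℕ) (σ : ℝ≥0) (a : ℝ) (b : Fin k → ℝ) :
    ∫⁻ w, ENNReal.ofReal ((a + b ⬝ᵥ w) ^ 2) ∂isoGaussian k σ
      = ENNReal.ofReal (a ^ 2) + ENNReal.ofReal (σ ^ 2 * (b ⬝ᵥ b)) := by
  rw [← ofReal_integral_eq_lintegral_ofReal, integral_sq_isoGaussian, ENNReal.ofReal_add]
  · positivity
  · exact mul_nonneg (by positivity) (dotProduct_self_nonneg b)
  · exact ((memLp_const a).add (memLp_dotProduct_isoGaussian k σ b)).integrable_sq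
  · exact Filter.Eventually.of_forall fun w => sq_nonneg _

/-- The logarithm of the likelihood ratio of the law of `δ + w` to that of `w`. -/
noncomputable def shiftLogDensity {k : ℕ} (σ : ℝ≥0) (δ w : Fin k → ℝ) : ℝ :=
  (δ ⬝ᵥ w) / σ ^ 2 - (δ ⬝ᵥ δ) / σ ^ 2 / 2

theorem gaussianReal_map_const_add_eq_withDensity {v : ℝ≥0} (hv : v ≠ 0) (c : ℝ) :
    (gaussianReal 0 v).map (c + ·)
      = (gaussianReal 0 v).withDensity (fun x => ENNReal.ofReal (Real.exp (c * x / v - c * c / v / 2))) := by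
  rw [gaussianReal_map_const_add, gaussianReal_of_var_ne_zero _ hv,
    gaussianReal_of_var_ne_zero _ hv, ← withDensity_mul _ (by fun_prop) (by fun_prop)]
  congr 1
  ext x
  simp only [Pi.mul_apply, gaussianPDF]
  rw [← ENNReal.ofReal_mul (gaussianPDFReal_nonneg _ _ _)]
  congr 1
  simp only [gaussianPDFReal]
  rw [mul_assoc _ (Real.exp _), ← Real.exp_add]
  congr 2
  have : (v : ℝ) ≠ 0 := by exact_mod_cast hv
  field_simp
  ring

/-- Both sides are product measures; on boxes the exponential factors over the independent
coordinates, which reduces the claim to dimension one. -/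
theorem isoGaussian_map_const_add {k : ℕ} {σ : ℝ≥0} (hσ : σ ≠ 0) (δ : Fin k → ℝ) :
    (isoGaussian k σ).map (δ + ·)
      = (isoGaussian k σ).withDensity
        (fun w => ENNReal.ofReal (Real.exp (shiftLogDensity σ δ w))) := by
  have hv : σ ^ 2 ≠ 0 := pow_ne_zero 2 hσ
  set f : ℝ → ℝ → ℝ≥0∞ := fun c x => ENNReal.ofReal (Real.exp (c * x / (σ ^ 2 : ℝ≥0) - c * c / (σ ^ 2 : ℝ≥0) / 2)) with hf
  have hfm : ∀ c, Measurable (f c) := fun c => by fun_prop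
  have hprob : ∀ c : ℝ, IsProbabilityMeasure ((gaussianReal 0 (σ ^ 2)).withDensity (f c)) := fun c => by
    rw [hf, ← gaussianReal_map_const_add_eq_withDensity hv]
    exact Measure.isProbabilityMeasure_map (by fun_prop)
  have h1 : Measure.pi (fun i => (gaussianReal 0 (σ ^ 2)).map (δ i + ·))
      = (isoGaussian k σ).map (δ + ·) := by
    unfold isoGaussian
    have := Measure.pi_map_pi (μ := fun _ : Fin k => gaussianReal 0 (σ ^ 2))
      (f := fun i x => δ i + x) (fun i => by fun_prop)
    rw [← this]
    rfl
  rw [← h1]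
  simp_rw [gaussianReal_map_const_add_eq_withDensity hv]
  refine Measure.pi_eq fun s hs => ?_
  rw [withDensity_apply _ (MeasurableSet.univ_pi hs), ← lintegral_indicator (MeasurableSet.univ_pi hs)]
  have e : (Set.univ.pi s).indicator (fun w => ENNReal.ofReal (Real.exp (shiftLogDensity σ δ w)))
      = fun w => ∏ i, (s i).indicator (f (δ i)) (w i) := by
    ext w
    by_cases hw : w ∈ Set.univ.pi s
    · rw [Set.indicator_of_mem hw]
      have : ∀ i, (s i).indicator (f (δ i)) (w i) = f (δ i) (w i) := fun i =>
        Set.indicator_of_mem (hw i (Set.mem_univ i)) _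
      simp_rw [this, hf]
      rw [← ENNReal.ofReal_prod_of_nonneg fun i _ => (Real.exp_pos _).le, ← Real.exp_sum]
      congr 2
      simp only [shiftLogDensity, dotProduct, Finset.sum_sub_distrib, Finset.sum_div]
      push_cast
      rfl
    · rw [Set.indicator_of_notMem hw]
      simp only [Set.mem_univ_pi, not_forall] at hw
      obtain ⟨i, hi⟩ := hw
      exact (Finset.prod_eq_zero (Finset.mem_univ i) (Set.indicator_of_notMem hi _)).symm
  rw [e]
  have hind : iIndepFun (fun i (w : Fin k → ℝ) => (s i).indicator (f (δ i)) (w i)) (isoGaussian k σ) :=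
    iIndepFun_pi (μ := fun _ : Fin k => gaussianReal 0 (σ ^ 2))
      (X := fun i x => (s i).indicator (f (δ i)) x) fun i => ((hfm _).indicator (hs i)).aemeasurable
  have := lintegral_prod_eq_prod_lintegral_of_indepFun Finset.univ _ hind
    (fun i => ((hfm (δ i)).indicator (hs i)).comp (measurable_pi_apply i))
  rw [this]
  refine Finset.prod_congr rfl fun i _ => ?_
  rw [withDensity_apply _ (hs i), ← lintegral_indicator (hs i)]
  unfold isoGaussian
  exact (measurePreserving_eval (fun _ : Fin k => gaussianReal 0 (σ ^ 2)) i).lintegral_comp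
    ((hfm (δ i)).indicator (hs i))

theorem measurable_shiftLogDensity {α : Type*} [MeasurableSpace α] {k : ℕ} (σ : ℝ≥0)
    {f g : α → Fin k → ℝ} (hf : Measurable f) (hg : Measurable g) :
    Measurable (fun a => shiftLogDensity σ (f a) (g a)) := by
  unfold shiftLogDensity
  exact ((measurable_dotProduct hf hg).div_const _).sub
    (((measurable_dotProduct hf hf).div_const _).div_const _)

/-- The form used for one transition: `m` and `m'` are the conditional means of the next state under
the two systems, and the noise is the one seen from `m`. -/
theorem lintegral_isoGaussian_shift {k : ℕ} {σ : ℝ≥0} (hσ : σ ≠ 0) (m m' : Fin k → ℝ)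
    {F : (Fin k → ℝ) → ℝ≥0∞} (hF : Measurable F) :
    ∫⁻ w, F (m' + w) ∂isoGaussian k σ
      = ∫⁻ w, ENNReal.ofReal (Real.exp (shiftLogDensity σ (m' - m) w)) * F (m + w)
          ∂isoGaussian k σ := by
  have hG : Measurable (fun w => F (m + w)) := hF.comp (measurable_const.add measurable_id)
  have h := isoGaussian_map_const_add hσ (m' - m)
  have h1 : ∫⁻ w, F (m' + w) ∂isoGaussian k σ
      = ∫⁻ w, F (m + w) ∂((isoGaussian k σ).map ((m' - m) + ·)) := by
    rw [lintegral_map hG (by fun_prop)]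
    refine lintegral_congr fun w => ?_
    congr 1
    ext i
    simp
    ring
  rw [h1, h, lintegral_withDensity_eq_lintegral_mul _ _ hG]
  · rfl
  · exact (Real.measurable_exp.comp (measurable_shiftLogDensity σ measurable_const measurable_id)).ennreal_ofReal

theorem lintegral_gaussianKernel {α : Type*} [MeasurableSpace α] {k : ℕ} (f : α → Fin k → ℝ)
    (hf : Measurable f) (σ : ℝ≥0) (a : α) {F : (Fin k → ℝ) → ℝ≥0∞} (hF : Measurable F) :
    ∫⁻ y, F y ∂gaussianKernel f hf σ a = ∫⁻ w, F (f a + w) ∂isoGaussian k σ := by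
  have hadd : Measurable (fun p : (Fin k → ℝ) × (Fin k → ℝ) => p.1 + p.2) :=
    measurable_fst.add measurable_snd
  rw [gaussianKernel, Kernel.lintegral_map _ hadd _ hF, Kernel.lintegral_deterministic_prod
    hf _ _ (g := fun p => F (p.1 + p.2)) (hF.comp hadd), Kernel.const_apply]

/-! ### Likelihood ratios along one rollout. -/

section Trajectories

variable {Θ : Type} [MeasurableSpace Θ] {n d : ℕ} (A A' : Matrix (Fin n) (Fin n) ℝ)
  (B B' : Matrix (Fin n) (Fin d) ℝ) (σ : ℝ≥0) (π : Policy Θ n d)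

theorem measurable_append {α : Type*} [MeasurableSpace α] {t : ℕ} {h : α → Traj n d t}
    {u : α → Fin d → ℝ} {y : α → Fin n → ℝ} (hh : Measurable h) (hu : Measurable u)
    (hy : Measurable y) :
    Measurable (fun a => (Fin.snoc (α := fun _ => (Fin d → ℝ) × (Fin n → ℝ)) (h a) (u a, y a) :
      Traj n d (t + 1))) :=
  (measurable_snoc t).comp (hh.prodMk (hu.prodMk hy))

theorem measurable_affine {α : Type*} [MeasurableSpace α] {x : α → Fin n → ℝ} {u : α → Fin d → ℝ}
    (hx : Measurable x) (hu : Measurable u) : Measurable (fun a => A *ᵥ x a + B *ᵥ u a) :=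
  (measurable_drift A B).comp (hx.prodMk hu)

theorem lintegral_trajLaw_succ [∀ t, IsMarkovKernel (π t)] (t : ℕ) (θ : Θ)
    {F : Traj n d (t + 1) → ℝ≥0∞} (hF : Measurable F) :
    ∫⁻ h, F h ∂trajLaw A B σ π (t + 1) θ
      = ∫⁻ h, ∫⁻ u, ∫⁻ w, F (Fin.snoc (α := fun _ => (Fin d → ℝ) × (Fin n → ℝ)) h
          (u, A *ᵥ curState t h + B *ᵥ u + w)) ∂isoGaussian n σ ∂π t (θ, h)
          ∂trajLaw A B σ π t θ := by
  have hs := measurable_snoc (X := (Fin d → ℝ) × (Fin n → ℝ)) t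
  have hG : Measurable (fun p : Traj n d t × ((Fin d → ℝ) × (Fin n → ℝ)) => F (Fin.snoc (α := fun _ => (Fin d → ℝ) × (Fin n → ℝ)) p.1 p.2)) :=
    hF.comp hs
  rw [trajLaw, Kernel.lintegral_map _ hs _ hF, Kernel.lintegral_compProd _ _ _ hG]
  refine lintegral_congr fun h => ?_
  rw [Kernel.lintegral_compProd _ _ _ (f := fun c => F (Fin.snoc
    (α := fun _ => (Fin d → ℝ) × (Fin n → ℝ)) h c)) (hG.comp measurable_prodMk_left)]
  refine lintegral_congr fun u => ?_
  rw [Kernel.comap_apply, dynamics, lintegral_gaussianKernel]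
  exact hG.comp (measurable_const.prodMk (measurable_const.prodMk measurable_id))

theorem measurable_lintegral_step [∀ t, IsMarkovKernel (π t)] (t : ℕ) (θ : Θ)
    {F : Traj n d t → (Fin d → ℝ) → (Fin n → ℝ) → ℝ≥0∞}
    (hF : Measurable (fun p : (Traj n d t × (Fin d → ℝ)) × (Fin n → ℝ) => F p.1.1 p.1.2 p.2)) :
    Measurable (fun h => ∫⁻ u, ∫⁻ w, F h u w ∂isoGaussian n σ ∂π t (θ, h)) := by
  have h1 : Measurable (fun p : Traj n d t × (Fin d → ℝ) => ∫⁻ w, F p.1 p.2 w ∂isoGaussian n σ) :=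
    hF.lintegral_prod_right'
  exact h1.lintegral_kernel_prod_right' (κ := (π t).comap (fun h => (θ, h)) measurable_prodMk_left)

/-- The additive functional `∑_s g(x_s, u_s, x_{s+1})` of a trajectory. -/
noncomputable def pathSum {n d : ℕ} (g : (Fin n → ℝ) → (Fin d → ℝ) → (Fin n → ℝ) → ℝ) :
    (t : ℕ) → Traj n d t → ℝ
  | 0, _ => 0
  | t + 1, h => pathSum g t (Fin.init h) +
      g (curState t (Fin.init h)) (h (Fin.last t)).1 (h (Fin.last t)).2

theorem pathSum_snoc (g : (Fin n → ℝ) → (Fin d → ℝ) → (Fin n → ℝ) → ℝ) (t : ℕ) (h : Traj n d t)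
    (u : Fin d → ℝ) (y : Fin n → ℝ) :
    pathSum g (t + 1) (Fin.snoc (α := fun _ => (Fin d → ℝ) × (Fin n → ℝ)) h (u, y))
      = pathSum g t h + g (curState t h) u y := by
  simp [pathSum]

theorem measurable_pathSum {α : Type*} [MeasurableSpace α]
    {g : α → (Fin n → ℝ) → (Fin d → ℝ) → (Fin n → ℝ) → ℝ}
    (hg : Measurable (fun p : α × (Fin n → ℝ) × (Fin d → ℝ) × (Fin n → ℝ) =>
      g p.1 p.2.1 p.2.2.1 p.2.2.2)) (t : ℕ) {h : α → Traj n d t} (hh : Measurable h) :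
    Measurable (fun a => pathSum (g a) t (h a)) := by
  induction t with
  | zero => exact measurable_const
  | succ t ih =>
    have hi : Measurable (fun a => (Fin.init (h a) : Traj n d t)) :=
      measurable_pi_lambda _ fun i => (measurable_pi_apply _).comp hh
    have hl : Measurable (fun a => h a (Fin.last t)) := (measurable_pi_apply _).comp hh
    exact (ih hi).add (hg.comp (measurable_id.prodMk (((measurable_curState t).comp hi).prodMk
      ((measurable_fst.comp hl).prodMk (measurable_snd.comp hl)))))

/-- The difference of the conditional means of the next state under two systems. -/
noncomputable def driftDiff {n d : ℕ} (A A' : Matrix (Fin n) (Fin n) ℝ)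
    (B B' : Matrix (Fin n) (Fin d) ℝ) (x : Fin n → ℝ) (u : Fin d → ℝ) : Fin n → ℝ :=
  (A' *ᵥ x + B' *ᵥ u) - (A *ᵥ x + B *ᵥ u)

/-- The log-likelihood ratio of one transition under `(A', B')` and `(A, B)`. -/
noncomputable def stepLogRatio {n d : ℕ} (A A' : Matrix (Fin n) (Fin n) ℝ)
    (B B' : Matrix (Fin n) (Fin d) ℝ) (σ : ℝ≥0) (x : Fin n → ℝ) (u : Fin d → ℝ) (y : Fin n → ℝ) :
    ℝ :=
  shiftLogDensity σ (driftDiff A A' B B' x u) (y - (A *ᵥ x + B *ᵥ u))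

/-- The martingale part of `stepLogRatio`. -/
noncomputable def stepMartingale {n d : ℕ} (A A' : Matrix (Fin n) (Fin n) ℝ)
    (B B' : Matrix (Fin n) (Fin d) ℝ) (σ : ℝ≥0) (x : Fin n → ℝ) (u : Fin d → ℝ) (y : Fin n → ℝ) :
    ℝ :=
  (driftDiff A A' B B' x u ⬝ᵥ (y - (A *ᵥ x + B *ᵥ u))) / σ ^ 2

/-- The conditional variance of `stepMartingale`. -/
noncomputable def stepVariance {n d : ℕ} (A A' : Matrix (Fin n) (Fin n) ℝ)
    (B B' : Matrix (Fin n) (Fin d) ℝ) (σ : ℝ≥0) (x : Fin n → ℝ) (u : Fin d → ℝ)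
    (_ : Fin n → ℝ) : ℝ :=
  (driftDiff A A' B B' x u ⬝ᵥ driftDiff A A' B B' x u) / σ ^ 2

theorem stepVariance_nonneg (x : Fin n → ℝ) (u : Fin d → ℝ) (y : Fin n → ℝ) :
    0 ≤ stepVariance A A' B B' σ x u y :=
  div_nonneg (dotProduct_self_nonneg _) (by positivity)

theorem pathSum_nonneg {g : (Fin n → ℝ) → (Fin d → ℝ) → (Fin n → ℝ) → ℝ}
    (hg : ∀ x u y, 0 ≤ g x u y) (t : ℕ) (h : Traj n d t) : 0 ≤ pathSum g t h := by
  induction t with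
  | zero => exact le_rfl
  | succ t ih => exact add_nonneg (ih _) (hg _ _ _)

/-- The decomposition `L = M - V/2`, which lets second moments alone control the likelihood ratio.
-/
theorem pathSum_stepLogRatio (t : ℕ) (h : Traj n d t) :
    pathSum (stepLogRatio A A' B B' σ) t h = pathSum (stepMartingale A A' B B' σ) t h
      - pathSum (stepVariance A A' B B' σ) t h / 2 := by
  induction t with
  | zero => simp [pathSum]
  | succ t ih =>
    simp only [pathSum, ih, stepLogRatio, stepMartingale, stepVariance, shiftLogDensity]
    ring

section Measurability

variable {α : Type*} [MeasurableSpace α] {fA fA' : α → Matrix (Fin n) (Fin n) ℝ}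
  {fB fB' : α → Matrix (Fin n) (Fin d) ℝ} {x y : α → Fin n → ℝ} {u : α → Fin d → ℝ}

theorem measurable_driftDiff (hA : Measurable fA) (hA' : Measurable fA') (hB : Measurable fB)
    (hB' : Measurable fB') (hx : Measurable x) (hu : Measurable u) :
    Measurable (fun a => driftDiff (fA a) (fA' a) (fB a) (fB' a) (x a) (u a)) :=
  ((measurable_mulVec_prod hA' hx).add (measurable_mulVec_prod hB' hu)).sub
    ((measurable_mulVec_prod hA hx).add (measurable_mulVec_prod hB hu))

theorem measurable_stepLogRatio (hA : Measurable fA) (hA' : Measurable fA') (hB : Measurable fB)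
    (hB' : Measurable fB') (hx : Measurable x) (hu : Measurable u) (hy : Measurable y) :
    Measurable (fun a => stepLogRatio (fA a) (fA' a) (fB a) (fB' a) σ (x a) (u a) (y a)) :=
  measurable_shiftLogDensity σ (measurable_driftDiff hA hA' hB hB' hx hu)
    (hy.sub ((measurable_mulVec_prod hA hx).add (measurable_mulVec_prod hB hu)))

theorem measurable_stepMartingale (hx : Measurable x) (hu : Measurable u) (hy : Measurable y) :
    Measurable (fun a => stepMartingale A A' B B' σ (x a) (u a) (y a)) :=
  (measurable_dotProduct (measurable_driftDiff measurable_const measurable_const measurable_const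
    measurable_const hx hu) (hy.sub (measurable_affine A B hx hu))).div_const _

theorem measurable_stepVariance (hx : Measurable x) (hu : Measurable u) :
    Measurable (fun a => stepVariance A A' B B' σ (x a) (u a) (y a)) :=
  (measurable_dotProduct (measurable_driftDiff measurable_const measurable_const measurable_const
    measurable_const hx hu) (measurable_driftDiff measurable_const measurable_const measurable_const
    measurable_const hx hu)).div_const _

theorem measurable_pathSum_stepLogRatio (hA : Measurable fA) (hA' : Measurable fA')
    (hB : Measurable fB) (hB' : Measurable fB') (t : ℕ) {h : α → Traj n d t} (hh : Measurable h) :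
    Measurable (fun a => pathSum (stepLogRatio (fA a) (fA' a) (fB a) (fB' a) σ) t (h a)) := by
  refine measurable_pathSum ?_ t hh
  exact measurable_stepLogRatio σ (hA.comp measurable_fst) (hA'.comp measurable_fst)
    (hB.comp measurable_fst) (hB'.comp measurable_fst) (by fun_prop) (by fun_prop) (by fun_prop)

theorem measurable_pathSum_stepMartingale (t : ℕ) :
    Measurable (pathSum (n := n) (d := d) (stepMartingale A A' B B' σ) t) :=
  measurable_pathSum (α := Traj n d t) (g := fun _ => stepMartingale A A' B B' σ)
    (measurable_stepMartingale A A' B B' σ (by fun_prop) (by fun_prop) (by fun_prop)) t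
    measurable_id

theorem measurable_pathSum_stepVariance (t : ℕ) :
    Measurable (pathSum (n := n) (d := d) (stepVariance A A' B B' σ) t) :=
  measurable_pathSum (α := Traj n d t) (g := fun _ => stepVariance A A' B B' σ)
    (measurable_stepVariance A A' B B' σ (by fun_prop) (by fun_prop) (y := fun p => p.2.2.2)) t
    measurable_id

end Measurability

variable {σ}

/-- Change of measure between the trajectory laws of two systems under the same policy. -/
theorem lintegral_trajLaw_change [∀ t, IsMarkovKernel (π t)] (hσ : σ ≠ 0) (t : ℕ) (θ : Θ)
    {F : Traj n d t → ℝ≥0∞} (hF : Measurable F) :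
    ∫⁻ h, F h ∂trajLaw A' B' σ π t θ
      = ∫⁻ h, ENNReal.ofReal (Real.exp (pathSum (stepLogRatio A A' B B' σ) t h)) * F h
          ∂trajLaw A B σ π t θ := by
  induction t with
  | zero => simp [trajLaw, pathSum]
  | succ t ih =>
    have hcur : Measurable (fun p : (Traj n d t × (Fin d → ℝ)) × (Fin n → ℝ) =>
        curState t p.1.1) := (measurable_curState t).comp (by fun_prop)
    have hLR : Measurable (fun h : Traj n d (t + 1) =>
        ENNReal.ofReal (Real.exp (pathSum (stepLogRatio A A' B B' σ) (t + 1) h))) :=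
      (measurable_pathSum_stepLogRatio σ measurable_const measurable_const measurable_const
        measurable_const (t + 1) measurable_id).exp.ennreal_ofReal
    rw [lintegral_trajLaw_succ _ _ _ _ _ _ hF, lintegral_trajLaw_succ A B σ π t θ
      (F := fun h => ENNReal.ofReal (Real.exp (pathSum (stepLogRatio A A' B B' σ) (t + 1) h)) * F h)
      (hLR.mul hF)]
    have hG := measurable_lintegral_step (σ := σ) π t θ
      (F := fun h u w => F (Fin.snoc (α := fun _ => (Fin d → ℝ) × (Fin n → ℝ)) h
          (u, A' *ᵥ curState t h + B' *ᵥ u + w)))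
      (hF.comp (measurable_append (by fun_prop) (by fun_prop)
        ((measurable_affine A' B' hcur (by fun_prop)).add (by fun_prop))))
    -- The induction hypothesis is applied to the conditional expectation given the past. The policy
    -- is common to both systems, so the last step only adds the factor of its Gaussian transition.
    rw [ih hG]
    refine lintegral_congr fun h => ?_
    have hw : ∀ u : Fin d → ℝ, Measurable (fun y : Fin n → ℝ =>
        F (Fin.snoc (α := fun _ => (Fin d → ℝ) × (Fin n → ℝ)) h (u, y))) := fun u =>
      hF.comp (measurable_append measurable_const measurable_const measurable_id)
    rw [← lintegral_const_mul' _ _ ENNReal.ofReal_ne_top]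
    refine lintegral_congr fun u => ?_
    rw [lintegral_isoGaussian_shift hσ (A *ᵥ curState t h + B *ᵥ u) _ (hw u),
      ← lintegral_const_mul' _ _ ENNReal.ofReal_ne_top]
    refine lintegral_congr fun w => ?_
    rw [pathSum_snoc, Real.exp_add, ENNReal.ofReal_mul (Real.exp_pos _).le, ← mul_assoc]
    simp only [stepLogRatio, driftDiff, add_sub_cancel_left]

/-- The mean of the conditional variance of the log-likelihood ratio at time `t`. -/
noncomputable def meanStepVariance (σ : ℝ≥0) (t : ℕ) (θ : Θ) : ℝ≥0∞ :=
  ∫⁻ h, ∫⁻ u, ENNReal.ofReal (stepVariance A A' B B' σ (curState t h) u 0) ∂π t (θ, h)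
    ∂trajLaw A B σ π t θ

theorem lintegral_pathSum_stepVariance_le [∀ t, IsMarkovKernel (π t)] (t : ℕ) (θ : Θ)
    {b : ℝ≥0∞} (hb : ∀ s, meanStepVariance A A' B B' π σ s θ ≤ b) :
    ∫⁻ h, ENNReal.ofReal (pathSum (stepVariance A A' B B' σ) t h) ∂trajLaw A B σ π t θ
      ≤ t * b := by
  induction t with
  | zero => simp [pathSum]
  | succ t ih =>
    have hV := measurable_pathSum_stepVariance A A' B B' σ t
    rw [lintegral_trajLaw_succ _ _ _ _ _ _
      (measurable_pathSum_stepVariance A A' B B' σ (t + 1)).ennreal_ofReal]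
    calc _ = ∫⁻ h, (ENNReal.ofReal (pathSum (stepVariance A A' B B' σ) t h)
          + ∫⁻ u, ENNReal.ofReal (stepVariance A A' B B' σ (curState t h) u 0) ∂π t (θ, h))
          ∂trajLaw A B σ π t θ := by
          refine lintegral_congr fun h => ?_
          simp_rw [pathSum_snoc]
          simp_rw [ENNReal.ofReal_add (pathSum_nonneg (stepVariance_nonneg A A' B B' σ) t h)
            (stepVariance_nonneg A A' B B' σ (curState t h) _ _)]
          simp only [stepVariance, lintegral_const, measure_univ, mul_one]
          rw [lintegral_add_left measurable_const]
          simp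
      _ = _ + meanStepVariance A A' B B' π σ t θ := lintegral_add_left hV.ennreal_ofReal _
      _ ≤ t * b + b := add_le_add ih (hb t)
      _ = _ := by push_cast; ring

/-- Martingale increments are centered given the past, so their squares add up without cross terms.
The offset `a` stands for the sum over earlier rollouts when the bound is iterated over a record. -/
theorem lintegral_sq_pathSum_stepMartingale_le [∀ t, IsMarkovKernel (π t)] (hσ : σ ≠ 0) (t : ℕ)
    (θ : Θ) {b : ℝ≥0∞} (hb : ∀ s, meanStepVariance A A' B B' π σ s θ ≤ b) (a : ℝ) :
    ∫⁻ h, ENNReal.ofReal ((a + pathSum (stepMartingale A A' B B' σ) t h) ^ 2)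
      ∂trajLaw A B σ π t θ ≤ ENNReal.ofReal (a ^ 2) + t * b := by
  induction t with
  | zero => simp [pathSum, trajLaw]
  | succ t ih =>
    have hM := measurable_pathSum_stepMartingale A A' B B' σ t
    have hσ' : (σ : ℝ) ≠ 0 := by exact_mod_cast hσ
    rw [lintegral_trajLaw_succ A B σ π t θ (F := fun h => ENNReal.ofReal
      ((a + pathSum (stepMartingale A A' B B' σ) (t + 1) h) ^ 2)) ((measurable_const.add
      (measurable_pathSum_stepMartingale A A' B B' σ (t + 1))).pow_const 2).ennreal_ofReal]
    calc _ = ∫⁻ h, (ENNReal.ofReal ((a + pathSum (stepMartingale A A' B B' σ) t h) ^ 2)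
          + ∫⁻ u, ENNReal.ofReal (stepVariance A A' B B' σ (curState t h) u 0) ∂π t (θ, h))
          ∂trajLaw A B σ π t θ := by
          refine lintegral_congr fun h => ?_
          have key : ∀ u : Fin d → ℝ, ∫⁻ w, ENNReal.ofReal
              ((a + pathSum (stepMartingale A A' B B' σ) (t + 1)
                (Fin.snoc (α := fun _ => (Fin d → ℝ) × (Fin n → ℝ)) h
                  (u, A *ᵥ curState t h + B *ᵥ u + w))) ^ 2) ∂isoGaussian n σ
              = ENNReal.ofReal ((a + pathSum (stepMartingale A A' B B' σ) t h) ^ 2)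
                + ENNReal.ofReal (stepVariance A A' B B' σ (curState t h) u 0) := by
            intro u
            have e := lintegral_sq_isoGaussian n σ
              (a + pathSum (stepMartingale A A' B B' σ) t h)
              (((σ : ℝ) ^ 2)⁻¹ • driftDiff A A' B B' (curState t h) u)
            have e2 : (σ : ℝ) ^ 2 * ((((σ : ℝ) ^ 2)⁻¹ • driftDiff A A' B B' (curState t h) u) ⬝ᵥ
                (((σ : ℝ) ^ 2)⁻¹ • driftDiff A A' B B' (curState t h) u))
                = stepVariance A A' B B' σ (curState t h) u 0 := by
              simp only [smul_dotProduct, dotProduct_smul, smul_eq_mul, stepVariance]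
              field_simp
            rw [e2] at e
            rw [← e]
            refine lintegral_congr fun w => ?_
            rw [pathSum_snoc]
            congr 2
            simp only [stepMartingale, add_sub_cancel_left, smul_dotProduct, smul_eq_mul]
            ring
          simp_rw [key]
          rw [lintegral_add_left measurable_const]
          simp
      _ = _ + meanStepVariance A A' B B' π σ t θ :=
          lintegral_add_left ((measurable_const.add hM).pow_const 2).ennreal_ofReal _
      _ ≤ (ENNReal.ofReal (a ^ 2) + t * b) + b := add_le_add ih (hb t)
      _ = _ := by push_cast; ring

end Trajectories

/-! ### Likelihood ratios along the whole record. -/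

section Records

variable {n d T N : ℕ} (𝒜 : Algorithm n d T N) (A A' : Matrix (Fin n) (Fin n) ℝ)
  (B B' : Matrix (Fin n) (Fin d) ℝ) (σw σu : ℝ≥0)

theorem lintegral_recordLaw_succ (i : ℕ) {F : Record n d T (i + 1) → ℝ≥0∞} (hF : Measurable F) :
    ∫⁻ r, F r ∂recordLaw 𝒜 A B σw σu (i + 1)
      = ∫⁻ r, ∫⁻ K, ∫⁻ h, F (Fin.snoc (α := fun _ => Matrix (Fin d) (Fin n) ℝ × Traj n d T) r
          (K, h)) ∂trajLaw A B σw (noisyFeedback n d σu) T K ∂𝒜.gain i r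
          ∂recordLaw 𝒜 A B σw σu i := by
  have := 𝒜.gain_markov
  have hs := measurable_snoc (X := Matrix (Fin d) (Fin n) ℝ × Traj n d T) i
  have hG := hF.comp hs
  rw [recordLaw, lintegral_map hF hs]
  refine (Measure.lintegral_compProd hG).trans (lintegral_congr fun r => ?_)
  exact Kernel.lintegral_compProd _ _ _ (hG.comp measurable_prodMk_left)

theorem measurable_lintegral_rollout (i : ℕ) {F : Record n d T i → Matrix (Fin d) (Fin n) ℝ →
      Traj n d T → ℝ≥0∞}
    (hF : Measurable (fun p : (Record n d T i × Matrix (Fin d) (Fin n) ℝ) × Traj n d T =>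
      F p.1.1 p.1.2 p.2)) :
    Measurable (fun r => ∫⁻ K, ∫⁻ h, F r K h ∂trajLaw A B σw (noisyFeedback n d σu) T K
      ∂𝒜.gain i r) := by
  have := 𝒜.gain_markov
  have h1 : Measurable (fun p : Record n d T i × Matrix (Fin d) (Fin n) ℝ =>
      ∫⁻ h, F p.1 p.2 h ∂trajLaw A B σw (noisyFeedback n d σu) T p.2) :=
    hF.lintegral_kernel_prod_right' (κ := (trajLaw A B σw (noisyFeedback n d σu) T).comap
      (fun p : Record n d T i × Matrix (Fin d) (Fin n) ℝ => p.2) measurable_snd)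
  exact h1.lintegral_kernel_prod_right' (κ := 𝒜.gain i)

/-- The sum of an additive functional over the rollouts of a record. -/
noncomputable def recordSum (g : (Fin n → ℝ) → (Fin d → ℝ) → (Fin n → ℝ) → ℝ) (i : ℕ)
    (r : Record n d T i) : ℝ :=
  ∑ j, pathSum g T (r j).2

theorem recordSum_snoc (g : (Fin n → ℝ) → (Fin d → ℝ) → (Fin n → ℝ) → ℝ) (i : ℕ)
    (r : Record n d T i) (K : Matrix (Fin d) (Fin n) ℝ) (h : Traj n d T) :
    recordSum g (i + 1) (Fin.snoc (α := fun _ => Matrix (Fin d) (Fin n) ℝ × Traj n d T) r (K, h))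
      = recordSum g i r + pathSum g T h := by
  simp [recordSum, Fin.sum_univ_castSucc]

theorem recordSum_stepLogRatio (σ : ℝ≥0) (i : ℕ) (r : Record n d T i) :
    recordSum (stepLogRatio A A' B B' σ) i r = recordSum (stepMartingale A A' B B' σ) i r
      - recordSum (stepVariance A A' B B' σ) i r / 2 := by
  simp only [recordSum, pathSum_stepLogRatio, Finset.sum_sub_distrib, Finset.sum_div]

theorem recordSum_stepVariance_nonneg (σ : ℝ≥0) (i : ℕ) (r : Record n d T i) :
    0 ≤ recordSum (stepVariance A A' B B' σ) i r :=
  Finset.sum_nonneg fun _ _ => pathSum_nonneg (stepVariance_nonneg A A' B B' σ) _ _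

theorem measurable_recordSum_stepLogRatio {α : Type*} [MeasurableSpace α]
    {fA fA' : α → Matrix (Fin n) (Fin n) ℝ} {fB fB' : α → Matrix (Fin n) (Fin d) ℝ} (σ : ℝ≥0)
    (hA : Measurable fA) (hA' : Measurable fA') (hB : Measurable fB) (hB' : Measurable fB')
    (i : ℕ) {r : α → Record n d T i} (hr : Measurable r) :
    Measurable (fun a => recordSum (stepLogRatio (fA a) (fA' a) (fB a) (fB' a) σ) i (r a)) :=
  Finset.measurable_sum _ fun j _ => measurable_pathSum_stepLogRatio σ hA hA' hB hB' T
    (measurable_snd.comp ((measurable_pi_apply j).comp hr))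

theorem measurable_recordSum {g : (Fin n → ℝ) → (Fin d → ℝ) → (Fin n → ℝ) → ℝ}
    (hg : Measurable (pathSum g T)) (i : ℕ) : Measurable (recordSum (T := T) g i) :=
  Finset.measurable_sum _ fun j _ => hg.comp (measurable_snd.comp (measurable_pi_apply j))

variable {σw}

/-- Change of measure between the laws of the records that an algorithm produces on two systems. -/
theorem lintegral_recordLaw_change (hσ : σw ≠ 0) (i : ℕ)
    {F : Record n d T i → ℝ≥0∞} (hF : Measurable F) :
    ∫⁻ r, F r ∂recordLaw 𝒜 A' B' σw σu i
      = ∫⁻ r, ENNReal.ofReal (Real.exp (recordSum (stepLogRatio A A' B B' σw) i r)) * F r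
          ∂recordLaw 𝒜 A B σw σu i := by
  induction i with
  | zero => simp [recordLaw, recordSum]
  | succ i ih =>
    have hLR : Measurable (fun r : Record n d T (i + 1) =>
        ENNReal.ofReal (Real.exp (recordSum (stepLogRatio A A' B B' σw) (i + 1) r))) :=
      (measurable_recordSum_stepLogRatio σw measurable_const measurable_const measurable_const
        measurable_const (i + 1) measurable_id).exp.ennreal_ofReal
    have hs := measurable_snoc (X := Matrix (Fin d) (Fin n) ℝ × Traj n d T) i
    rw [lintegral_recordLaw_succ _ _ _ _ _ _ hF, lintegral_recordLaw_succ 𝒜 A B σw σu i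
      (F := fun r => ENNReal.ofReal (Real.exp (recordSum (stepLogRatio A A' B B' σw) (i + 1) r))
        * F r) (hLR.mul hF)]
    have hG := measurable_lintegral_rollout 𝒜 A' B' σw σu i
      (F := fun r K h => F (Fin.snoc (α := fun _ => Matrix (Fin d) (Fin n) ℝ × Traj n d T) r
        (K, h)))
      (hF.comp (hs.comp ((measurable_fst.comp measurable_fst).prodMk
        ((measurable_snd.comp measurable_fst).prodMk measurable_snd))))
    rw [ih hG]
    refine lintegral_congr fun r => ?_
    rw [← lintegral_const_mul' _ _ ENNReal.ofReal_ne_top]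
    refine lintegral_congr fun K => ?_
    rw [lintegral_trajLaw_change A A' B B' _ hσ T K (F := fun h => F (Fin.snoc
        (α := fun _ => Matrix (Fin d) (Fin n) ℝ × Traj n d T) r (K, h)))
        (hF.comp (hs.comp (measurable_const.prodMk (measurable_const.prodMk measurable_id)))),
      ← lintegral_const_mul' _ _ ENNReal.ofReal_ne_top]
    refine lintegral_congr fun h => ?_
    rw [recordSum_snoc, Real.exp_add, ENNReal.ofReal_mul (Real.exp_pos _).le, ← mul_assoc]

open scoped Matrix.Norms.L2Operator in
theorem lintegral_recordSum_stepVariance_le (i : ℕ) {b : ℝ≥0∞}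
    (hb : ∀ K : Matrix (Fin d) (Fin n) ℝ, ‖K‖ ≤ 1 → ∀ s,
      meanStepVariance A A' B B' (noisyFeedback n d σu) σw s K ≤ b) :
    ∫⁻ r, ENNReal.ofReal (recordSum (stepVariance A A' B B' σw) i r) ∂recordLaw 𝒜 A B σw σu i
      ≤ i * (T * b) := by
  have := 𝒜.gain_markov
  have hV := measurable_pathSum_stepVariance A A' B B' σw T
  induction i with
  | zero => simp [recordSum]
  | succ i ih =>
    rw [lintegral_recordLaw_succ _ _ _ _ _ _ (measurable_recordSum hV (i + 1)).ennreal_ofReal]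
    calc _ ≤ ∫⁻ r, (ENNReal.ofReal (recordSum (stepVariance A A' B B' σw) i r) + T * b)
          ∂recordLaw 𝒜 A B σw σu i := by
          refine lintegral_mono fun r => ?_
          have h1 : ∀ᵐ K ∂𝒜.gain i r, ∫⁻ h, ENNReal.ofReal
              (recordSum (stepVariance A A' B B' σw) (i + 1)
                (Fin.snoc (α := fun _ => Matrix (Fin d) (Fin n) ℝ × Traj n d T) r (K, h)))
              ∂trajLaw A B σw (noisyFeedback n d σu) T K
              ≤ ENNReal.ofReal (recordSum (stepVariance A A' B B' σw) i r) + T * b := by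
            -- The bound on one step holds only for gains of norm at most one, which are almost
            -- surely the ones played.
            filter_upwards [𝒜.norm_gain_le i r] with K hK
            simp_rw [recordSum_snoc, ENNReal.ofReal_add
              (recordSum_stepVariance_nonneg A A' B B' σw i r)
              (pathSum_nonneg (stepVariance_nonneg A A' B B' σw) T _)]
            rw [lintegral_add_left measurable_const]
            refine add_le_add (by simp) ?_
            exact lintegral_pathSum_stepVariance_le A A' B B' _ T K (hb K hK)
          exact (lintegral_mono_ae h1).trans (by simp)
      _ = ∫⁻ r, ENNReal.ofReal (recordSum (stepVariance A A' B B' σw) i r) ∂recordLaw 𝒜 A B σw σu i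
          + T * b := by
          rw [lintegral_add_right _ measurable_const]
          simp
      _ ≤ i * (T * b) + T * b := by gcongr
      _ = _ := by push_cast; ring

open scoped Matrix.Norms.L2Operator in
theorem lintegral_sq_recordSum_stepMartingale_le (hσ : σw ≠ 0) (i : ℕ) {b : ℝ≥0∞}
    (hb : ∀ K : Matrix (Fin d) (Fin n) ℝ, ‖K‖ ≤ 1 → ∀ s,
      meanStepVariance A A' B B' (noisyFeedback n d σu) σw s K ≤ b) :
    ∫⁻ r, ENNReal.ofReal (recordSum (stepMartingale A A' B B' σw) i r ^ 2)
      ∂recordLaw 𝒜 A B σw σu i ≤ i * (T * b) := by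
  have := 𝒜.gain_markov
  have hM := measurable_pathSum_stepMartingale A A' B B' σw T
  induction i with
  | zero => simp [recordSum]
  | succ i ih =>
    rw [lintegral_recordLaw_succ _ _ _ _ _ _
      ((measurable_recordSum hM (i + 1)).pow_const 2).ennreal_ofReal]
    calc _ ≤ ∫⁻ r, (ENNReal.ofReal (recordSum (stepMartingale A A' B B' σw) i r ^ 2) + T * b)
          ∂recordLaw 𝒜 A B σw σu i := by
          refine lintegral_mono fun r => ?_
          have h1 : ∀ᵐ K ∂𝒜.gain i r, ∫⁻ h, ENNReal.ofReal
              (recordSum (stepMartingale A A' B B' σw) (i + 1)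
                (Fin.snoc (α := fun _ => Matrix (Fin d) (Fin n) ℝ × Traj n d T) r (K, h)) ^ 2)
              ∂trajLaw A B σw (noisyFeedback n d σu) T K
              ≤ ENNReal.ofReal (recordSum (stepMartingale A A' B B' σw) i r ^ 2) + T * b := by
            filter_upwards [𝒜.norm_gain_le i r] with K hK
            simp_rw [recordSum_snoc]
            exact lintegral_sq_pathSum_stepMartingale_le A A' B B' _ hσ T K (hb K hK) _
          exact (lintegral_mono_ae h1).trans (by simp)
      _ = ∫⁻ r, ENNReal.ofReal (recordSum (stepMartingale A A' B B' σw) i r ^ 2) ∂recordLaw 𝒜 A B σw σu i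
          + T * b := by
          rw [lintegral_add_right _ measurable_const]
          simp
      _ ≤ i * (T * b) + T * b := by gcongr
      _ = _ := by push_cast; ring

end Records

/-! ### Second moments of the state under noisy feedback. -/

section Moments

variable {n d : ℕ} (A : Matrix (Fin n) (Fin n) ℝ) (B : Matrix (Fin n) (Fin d) ℝ) (σw σu : ℝ≥0)

theorem measurable_linear {k : ℕ} (a : ℝ) (b : Fin k → ℝ) :
    Measurable (fun x : Fin k → ℝ => ENNReal.ofReal ((a + b ⬝ᵥ x) ^ 2)) :=
  ((measurable_const.add (measurable_dotProduct measurable_const measurable_id)).pow_const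
    2).ennreal_ofReal

theorem lintegral_sq_noisyFeedback (K : Matrix (Fin d) (Fin n) ℝ) (t : ℕ) (h : Traj n d t)
    (a : Fin n → ℝ) (c : Fin d → ℝ) :
    ∫⁻ u, ENNReal.ofReal ((a ⬝ᵥ curState t h + c ⬝ᵥ u) ^ 2) ∂noisyFeedback n d σu t (K, h)
      = ENNReal.ofReal (((a + c ᵥ* K) ⬝ᵥ curState t h) ^ 2)
        + ENNReal.ofReal (σu ^ 2 * (c ⬝ᵥ c)) := by
  rw [noisyFeedback, lintegral_gaussianKernel _ _ _ _ (measurable_linear _ _),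
    ← lintegral_sq_isoGaussian]
  refine lintegral_congr fun w => ?_
  rw [dotProduct_add, add_dotProduct, ← dotProduct_mulVec, add_assoc]

theorem curState_snoc (t : ℕ) (h : Traj n d t) (u : Fin d → ℝ) (y : Fin n → ℝ) :
    curState (t + 1) (Fin.snoc (α := fun _ => (Fin d → ℝ) × (Fin n → ℝ)) h (u, y)) = y := by
  simp [curState]

/-- In direction `v`, the next state is the current one in direction `v(A + BK)` plus independent
noise of variance at most `S |v|²`, where `S = σw² + σu²`. The first hypothesis says that `v ↦ v(A +
BK)` halves lengths, so the bound `2S` reproduces itself: `2S/4 + S ≤ 2S`. The induction needs all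
directions at once. -/
theorem lintegral_sq_curState_le {K : Matrix (Fin d) (Fin n) ℝ}
    (hL : ∀ v, (v ᵥ* A + (v ᵥ* B) ᵥ* K) ⬝ᵥ (v ᵥ* A + (v ᵥ* B) ᵥ* K) ≤ (v ⬝ᵥ v) / 4)
    (hB : ∀ v, (v ᵥ* B) ⬝ᵥ (v ᵥ* B) ≤ v ⬝ᵥ v) (t : ℕ) (v : Fin n → ℝ) :
    ∫⁻ h, ENNReal.ofReal ((v ⬝ᵥ curState t h) ^ 2) ∂trajLaw A B σw (noisyFeedback n d σu) t K
      ≤ ENNReal.ofReal (2 * ((σw : ℝ) ^ 2 + (σu : ℝ) ^ 2) * (v ⬝ᵥ v)) := by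
  induction t generalizing v with
  | zero => simp [curState]
  | succ t ih =>
    have hm : Measurable (fun h : Traj n d (t + 1) =>
        ENNReal.ofReal ((v ⬝ᵥ curState (t + 1) h) ^ 2)) :=
      ((measurable_dotProduct measurable_const (measurable_curState _)).pow_const 2).ennreal_ofReal
    have hm' : Measurable (fun h : Traj n d t => ENNReal.ofReal
        (((v ᵥ* A + (v ᵥ* B) ᵥ* K) ⬝ᵥ curState t h) ^ 2)) :=
      ((measurable_dotProduct measurable_const (measurable_curState _)).pow_const 2).ennreal_ofReal
    rw [lintegral_trajLaw_succ _ _ _ _ _ _ hm]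
    have key : ∀ h : Traj n d t, ∫⁻ u, ∫⁻ w, ENNReal.ofReal ((v ⬝ᵥ curState (t + 1)
        (Fin.snoc (α := fun _ => (Fin d → ℝ) × (Fin n → ℝ)) h
          (u, A *ᵥ curState t h + B *ᵥ u + w))) ^ 2) ∂isoGaussian n σw
          ∂noisyFeedback n d σu t (K, h)
        = ENNReal.ofReal (((v ᵥ* A + (v ᵥ* B) ᵥ* K) ⬝ᵥ curState t h) ^ 2)
          + (ENNReal.ofReal (σu ^ 2 * ((v ᵥ* B) ⬝ᵥ (v ᵥ* B)))
            + ENNReal.ofReal (σw ^ 2 * (v ⬝ᵥ v))) := by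
      intro h
      simp only [curState_snoc, dotProduct_add, lintegral_sq_isoGaussian]
      rw [lintegral_add_right _ measurable_const]
      simp only [dotProduct_mulVec, lintegral_sq_noisyFeedback]
      rw [lintegral_const, measure_univ, mul_one, add_assoc]
    simp_rw [key]
    rw [lintegral_add_left hm', lintegral_const, measure_univ, mul_one]
    refine (add_le_add_left (ih _) _).trans ?_
    have hv := dotProduct_self_nonneg v
    have hvB := dotProduct_self_nonneg (v ᵥ* B)
    rw [← ENNReal.ofReal_add (by positivity) (by positivity), ← ENNReal.ofReal_add
      (mul_nonneg (by positivity) (dotProduct_self_nonneg _)) (by positivity)]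
    refine ENNReal.ofReal_le_ofReal ?_
    have h1 := mul_le_mul_of_nonneg_left (hL v)
      (by positivity : (0 : ℝ) ≤ 2 * ((σw : ℝ) ^ 2 + (σu : ℝ) ^ 2))
    have h2 := mul_le_mul_of_nonneg_left (hB v) (by positivity : (0 : ℝ) ≤ (σu : ℝ) ^ 2)
    have h3 : 0 ≤ (σw : ℝ) ^ 2 * (v ⬝ᵥ v) := by positivity
    have h4 : 0 ≤ (σu : ℝ) ^ 2 * (v ⬝ᵥ v) := by positivity
    linarith

theorem lintegral_normSq_mulVec (σ : ℝ≥0) {l k : ℕ} (M : Matrix (Fin l) (Fin k) ℝ)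
    (m : Fin k → ℝ) :
    ∫⁻ w, ENNReal.ofReal ((M *ᵥ (m + w)) ⬝ᵥ (M *ᵥ (m + w))) ∂isoGaussian k σ
      = ENNReal.ofReal ((M *ᵥ m) ⬝ᵥ (M *ᵥ m))
        + ENNReal.ofReal (σ ^ 2 * ∑ i, M.row i ⬝ᵥ M.row i) := by
  have e : ∀ x : Fin l → ℝ, ENNReal.ofReal (x ⬝ᵥ x) = ∑ i, ENNReal.ofReal (x i ^ 2) := fun x => by
    rw [← ENNReal.ofReal_sum_of_nonneg fun i _ => sq_nonneg _]
    simp [dotProduct, sq]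
  have e' : ENNReal.ofReal (σ ^ 2 * ∑ i, M.row i ⬝ᵥ M.row i)
      = ∑ i, ENNReal.ofReal (σ ^ 2 * (M.row i ⬝ᵥ M.row i)) := by
    rw [Finset.mul_sum, ENNReal.ofReal_sum_of_nonneg
      fun i _ => mul_nonneg (by positivity) (dotProduct_self_nonneg _)]
  have e'' : ∀ x i, (M *ᵥ x) i = M.row i ⬝ᵥ x := fun _ _ => rfl
  simp_rw [e, e', e'', dotProduct_add]
  rw [lintegral_finsetSum _ fun i _ => measurable_linear _ _]
  simp_rw [lintegral_sq_isoGaussian]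
  rw [Finset.sum_add_distrib]

end Moments

/-! ### The optimal cost and the excess cost of a gain. -/

section Costs

variable {n d : ℕ} (A : Matrix (Fin n) (Fin n) ℝ) (B : Matrix (Fin n) (Fin d) ℝ) (σw : ℝ≥0)

theorem measurable_normSq_curState {l t : ℕ} (M : Matrix (Fin l) (Fin n) ℝ) :
    Measurable (fun h : Traj n d t => ENNReal.ofReal
      ((M *ᵥ curState t h) ⬝ᵥ (M *ᵥ curState t h))) := by
  have h := measurable_mulVec_prod (measurable_const (a := M)) (measurable_curState (n := n) (d := d) t)
  exact (measurable_dotProduct h h).ennreal_ofReal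

theorem measurable_pathCost (t : ℕ) : Measurable (pathCost (n := n) (d := d) (T := t)) :=
  Finset.measurable_sum _ fun i _ =>
    measurable_dotProduct (measurable_snd.comp (measurable_pi_apply i))
      (measurable_snd.comp (measurable_pi_apply i))

theorem pathCost_nonneg {t : ℕ} (h : Traj n d t) : 0 ≤ pathCost h :=
  Finset.sum_nonneg fun _ _ => dotProduct_self_nonneg _

theorem lintegral_pathCost_succ {Θ : Type} [MeasurableSpace Θ] (π : Policy Θ n d)
    [∀ t, IsMarkovKernel (π t)] (t : ℕ) (θ : Θ) :
    ∫⁻ h, ENNReal.ofReal (pathCost h) ∂trajLaw A B σw π (t + 1) θ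
      = ∫⁻ h, ENNReal.ofReal (pathCost h) ∂trajLaw A B σw π t θ
        + ∫⁻ h, ∫⁻ u, ENNReal.ofReal ((A *ᵥ curState t h + B *ᵥ u) ⬝ᵥ
            (A *ᵥ curState t h + B *ᵥ u)) ∂π t (θ, h) ∂trajLaw A B σw π t θ
        + ENNReal.ofReal (σw ^ 2 * n) := by
  rw [lintegral_trajLaw_succ _ _ _ _ _ _ (measurable_pathCost _).ennreal_ofReal]
  have key : ∀ h : Traj n d t, ∫⁻ u, ∫⁻ w, ENNReal.ofReal (pathCost
        (Fin.snoc (α := fun _ => (Fin d → ℝ) × (Fin n → ℝ)) h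
          (u, A *ᵥ curState t h + B *ᵥ u + w) : Traj n d (t + 1))) ∂isoGaussian n σw ∂π t (θ, h)
      = ENNReal.ofReal (pathCost h) + (∫⁻ u, ENNReal.ofReal ((A *ᵥ curState t h + B *ᵥ u) ⬝ᵥ
            (A *ᵥ curState t h + B *ᵥ u)) ∂π t (θ, h) + ENNReal.ofReal (σw ^ 2 * n)) := by
    intro h
    have e : ∀ u w, pathCost (Fin.snoc (α := fun _ => (Fin d → ℝ) × (Fin n → ℝ)) h
          (u, A *ᵥ curState t h + B *ᵥ u + w) : Traj n d (t + 1))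
        = pathCost h + (A *ᵥ curState t h + B *ᵥ u + w) ⬝ᵥ (A *ᵥ curState t h + B *ᵥ u + w) :=
      fun u w => by simp [pathCost, Fin.sum_univ_castSucc]
    have e' : ∀ m : Fin n → ℝ, ∫⁻ w, ENNReal.ofReal (pathCost h + (m + w) ⬝ᵥ (m + w))
        ∂isoGaussian n σw
        = ENNReal.ofReal (pathCost h)
          + (ENNReal.ofReal (m ⬝ᵥ m) + ENNReal.ofReal (σw ^ 2 * n)) := by
      intro m
      have := lintegral_normSq_mulVec σw (1 : Matrix (Fin n) (Fin n) ℝ) m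
      have htr : ∑ i, (1 : Matrix (Fin n) (Fin n) ℝ).row i ⬝ᵥ (1 : Matrix (Fin n) (Fin n) ℝ).row i
          = (n : ℝ) := by
        simp [dotProduct, Matrix.one_apply, Matrix.row]
      simp only [one_mulVec, htr] at this
      rw [← this]
      simp_rw [ENNReal.ofReal_add (pathCost_nonneg h) (dotProduct_self_nonneg _)]
      rw [lintegral_add_left measurable_const]
      simp
    simp_rw [e, e']
    rw [lintegral_add_left measurable_const, lintegral_add_right _ measurable_const]
    simp
  simp_rw [key]
  rw [lintegral_add_left (measurable_pathCost _).ennreal_ofReal,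
    lintegral_add_right _ measurable_const]
  simp [add_assoc]

/-- A gain that cancels the drift leaves only fresh noise in every state. -/
theorem optCost_le {K : Matrix (Fin d) (Fin n) ℝ} (hK : A + B * K = 0) (T : ℕ) :
    optCost A B σw T ≤ T * ENNReal.ofReal (σw ^ 2 * n) := by
  have hφ : ∀ t, Measurable (fun h : Traj n d t => K *ᵥ curState t h) := fun t =>
    measurable_mulVec_prod measurable_const (measurable_curState t)
  refine (iInf₂_le (fun t h => K *ᵥ curState t h) hφ).trans ?_
  induction T with
  | zero => simp [pathCost]
  | succ t ih =>
    rw [lintegral_pathCost_succ]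
    have h0 : ∀ h : Traj n d t, ∫⁻ u, ENNReal.ofReal ((A *ᵥ curState t h + B *ᵥ u) ⬝ᵥ
            (A *ᵥ curState t h + B *ᵥ u))
          ∂ofFun (fun t h => K *ᵥ curState t h) hφ t ((), h) = 0 := by
      intro h
      rw [ofFun, Kernel.lintegral_deterministic', mulVec_mulVec, ← add_mulVec, hK]
      · simp
      · exact (measurable_dotProduct (measurable_affine A B measurable_const measurable_id)
          (measurable_affine A B measurable_const measurable_id)).ennreal_ofReal
    simp_rw [h0]
    rw [lintegral_zero, add_zero]
    push_cast
    rw [add_mul, one_mul]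
    gcongr

/-- Each state `x_s` with `s ≥ 1` contains fresh noise, whose image under `A + BK` has mean energy
`σw²` times the squared Frobenius norm. Since `x_0 = 0`, this happens in `t` of the `t + 1`
transitions. -/
theorem le_gainCost (K : Matrix (Fin d) (Fin n) ℝ) (t : ℕ) :
    (t + 1 : ℕ) * ENNReal.ofReal (σw ^ 2 * n)
      + t * ENNReal.ofReal (σw ^ 2 * ∑ i, (A + B * K).row i ⬝ᵥ (A + B * K).row i)
      ≤ gainCost A B σw (t + 1) K := by
  have hstep : ∀ t, ∫⁻ h, ∫⁻ u, ENNReal.ofReal ((A *ᵥ curState t h + B *ᵥ u) ⬝ᵥ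
            (A *ᵥ curState t h + B *ᵥ u)) ∂feedback n d t (K, h)
            ∂trajLaw A B σw (feedback n d) t K
      = ∫⁻ h, ENNReal.ofReal (((A + B * K) *ᵥ curState t h) ⬝ᵥ ((A + B * K) *ᵥ curState t h))
            ∂trajLaw A B σw (feedback n d) t K := by
    intro t
    refine lintegral_congr fun h => ?_
    rw [feedback, Kernel.lintegral_deterministic', mulVec_mulVec, ← add_mulVec]
    exact (measurable_dotProduct (measurable_affine A B measurable_const measurable_id)
      (measurable_affine A B measurable_const measurable_id)).ennreal_ofReal
  unfold gainCost
  induction t with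
  | zero =>
    rw [lintegral_pathCost_succ]
    simp
  | succ t ih =>
    rw [lintegral_pathCost_succ, hstep, lintegral_trajLaw_succ _ _ _ _ _ _
      (measurable_normSq_curState _)]
    have h1 : ENNReal.ofReal (σw ^ 2 * ∑ i, (A + B * K).row i ⬝ᵥ (A + B * K).row i)
        ≤ ∫⁻ h, ∫⁻ u, ∫⁻ w, ENNReal.ofReal (((A + B * K) *ᵥ curState (t + 1)
          (Fin.snoc (α := fun _ => (Fin d → ℝ) × (Fin n → ℝ)) h
            (u, A *ᵥ curState t h + B *ᵥ u + w))) ⬝ᵥ ((A + B * K) *ᵥ curState (t + 1)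
          (Fin.snoc (α := fun _ => (Fin d → ℝ) × (Fin n → ℝ)) h
            (u, A *ᵥ curState t h + B *ᵥ u + w)))) ∂isoGaussian n σw ∂feedback n d t (K, h)
            ∂trajLaw A B σw (feedback n d) t K := by
      simp only [curState_snoc, lintegral_normSq_mulVec]
      -- The inner measure only rewrites a constant as a double integral; any probability measure
      -- serves.
      calc _ = ∫⁻ _, ∫⁻ _, ENNReal.ofReal (σw ^ 2 * ∑ i, (A + B * K).row i ⬝ᵥ (A + B * K).row i)
            ∂isoGaussian d 1 ∂trajLaw A B σw (feedback n d) t K := by simp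
        _ ≤ _ := by
          refine lintegral_mono fun h => ?_
          simp only [lintegral_const, measure_univ, mul_one]
          calc _ = ∫⁻ _, ENNReal.ofReal (σw ^ 2 * ∑ i, (A + B * K).row i ⬝ᵥ (A + B * K).row i)
                ∂feedback n d t (K, h) := by simp
            _ ≤ _ := lintegral_mono fun u => le_add_self
    calc _ = ((t + 1 : ℕ) * ENNReal.ofReal (σw ^ 2 * n)
            + t * ENNReal.ofReal (σw ^ 2 * ∑ i, (A + B * K).row i ⬝ᵥ (A + B * K).row i))
          + ENNReal.ofReal (σw ^ 2 * ∑ i, (A + B * K).row i ⬝ᵥ (A + B * K).row i)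
          + ENNReal.ofReal (σw ^ 2 * n) := by push_cast; ring
      _ ≤ _ := by gcongr

theorem le_gainCost_sub_optCost {K₀ : Matrix (Fin d) (Fin n) ℝ} (hK₀ : A + B * K₀ = 0)
    (K : Matrix (Fin d) (Fin n) ℝ) (t : ℕ) :
    t * ENNReal.ofReal (σw ^ 2 * ∑ i, (A + B * K).row i ⬝ᵥ (A + B * K).row i)
      ≤ gainCost A B σw (t + 1) K - optCost A B σw (t + 1) := by
  have h := optCost_le A B σw hK₀ (t + 1)
  have hfin : optCost A B σw (t + 1) ≠ ⊤ := ne_top_of_le_ne_top (by finiteness) h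
  refine ENNReal.le_sub_of_add_le_left hfin ?_
  exact (add_le_add_left h _).trans (le_gainCost A B σw K t)

end Costs

/-! ### The two-point bound. -/

section TwoPoint

/-- When the minimum is the exponential, `exp x ≥ 1 + x` and `M + M² ≥ -1/4` suffice. Integrated,
this bounds below the overlap `∫ min(dP, dP')` of the two record laws. -/
theorem three_quarters_le_min_exp (M V : ℝ) (hV : 0 ≤ V) :
    3 / 4 ≤ min 1 (Real.exp (M - V / 2)) + M ^ 2 + V := by
  rcases le_total 1 (Real.exp (M - V / 2)) with h | h
  · rw [min_eq_left h]
    nlinarith [sq_nonneg M]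
  · rw [min_eq_right h]
    nlinarith [Real.add_one_le_exp (M - V / 2), sq_nonneg (M + 1 / 2)]

open scoped Matrix.Norms.L2Operator in
/-- Two systems whose records have bounded relative entropy cannot both be handled well. -/
theorem le_lintegral_add_lintegral_recordLaw {n d T N : ℕ} (𝒜 : Algorithm n d T N)
    (A A' : Matrix (Fin n) (Fin n) ℝ) (B B' : Matrix (Fin n) (Fin d) ℝ) {σw : ℝ≥0} (σu : ℝ≥0)
    (hσ : σw ≠ 0) {b : ℝ≥0∞}
    (hb : ∀ K : Matrix (Fin d) (Fin n) ℝ, ‖K‖ ≤ 1 → ∀ s,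
      meanStepVariance A A' B B' (noisyFeedback n d σu) σw s K ≤ b)
    (hNT : N * (T * b) ≤ ENNReal.ofReal (1 / 4)) {g g' : Record n d T N → ℝ≥0∞}
    (hg' : Measurable g') {c : ℝ≥0∞} (hc : ∀ r, c ≤ g r + g' r) :
    ENNReal.ofReal (1 / 4) * c
      ≤ ∫⁻ r, g r ∂recordLaw 𝒜 A B σw σu N + ∫⁻ r, g' r ∂recordLaw 𝒜 A' B' σw σu N := by
  set P := recordLaw 𝒜 A B σw σu N
  set L : Record n d T N → ℝ := recordSum (stepLogRatio A A' B B' σw) N with hL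
  set M : Record n d T N → ℝ := recordSum (stepMartingale A A' B B' σw) N
  set V : Record n d T N → ℝ := recordSum (stepVariance A A' B B' σw) N
  have hM : Measurable M := measurable_recordSum (measurable_pathSum_stepMartingale A A' B B' σw T) N
  have hV : Measurable V := measurable_recordSum (measurable_pathSum_stepVariance A A' B B' σw T) N
  have hLm : Measurable L := measurable_recordSum_stepLogRatio σw measurable_const measurable_const
    measurable_const measurable_const N measurable_id
  have hmin : Measurable (fun r => ENNReal.ofReal (min 1 (Real.exp (L r)))) :=
    (measurable_const.min hLm.exp).ennreal_ofReal
  have hM2 : ∫⁻ r, ENNReal.ofReal (M r ^ 2) ∂P ≤ ENNReal.ofReal (1 / 4) :=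
    (lintegral_sq_recordSum_stepMartingale_le 𝒜 A A' B B' σu hσ N hb).trans hNT
  have hV2 : ∫⁻ r, ENNReal.ofReal (V r) ∂P ≤ ENNReal.ofReal (1 / 4) :=
    (lintegral_recordSum_stepVariance_le 𝒜 A A' B B' σu N hb).trans hNT
  have h1 : ENNReal.ofReal (3 / 4) ≤ ∫⁻ r, ENNReal.ofReal (min 1 (Real.exp (L r))) ∂P
      + ∫⁻ r, ENNReal.ofReal (M r ^ 2) ∂P + ∫⁻ r, ENNReal.ofReal (V r) ∂P := by
    rw [← lintegral_add_left hmin, ← lintegral_add_right _ hV.ennreal_ofReal]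
    calc ENNReal.ofReal (3 / 4) = ∫⁻ _, ENNReal.ofReal (3 / 4) ∂P := by simp [P]
      _ ≤ _ := by
        refine lintegral_mono fun r => ?_
        have hVr : 0 ≤ V r := recordSum_stepVariance_nonneg A A' B B' σw N r
        rw [← ENNReal.ofReal_add (by positivity) (by positivity),
          ← ENNReal.ofReal_add (by positivity) hVr]
        refine ENNReal.ofReal_le_ofReal ?_
        rw [show L r = M r - V r / 2 from recordSum_stepLogRatio A A' B B' σw N r]
        exact three_quarters_le_min_exp _ _ hVr
  have h2 : ENNReal.ofReal (1 / 4) ≤ ∫⁻ r, ENNReal.ofReal (min 1 (Real.exp (L r))) ∂P := by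
    -- The overlap is at least `3/4 - 1/4 - 1/4`.
    have h3 := h1.trans (add_le_add (add_le_add le_rfl hM2) hV2)
    rw [add_assoc, ← ENNReal.ofReal_add (by norm_num) (by norm_num)] at h3
    have h4 : ENNReal.ofReal (3 / 4)
        = ENNReal.ofReal (1 / 4) + ENNReal.ofReal (1 / 4 + 1 / 4) := by
      rw [← ENNReal.ofReal_add (by norm_num) (by norm_num)]
      norm_num
    rw [h4] at h3
    exact (ENNReal.add_le_add_iff_right ENNReal.ofReal_ne_top).1 h3
  rw [lintegral_recordLaw_change 𝒜 A A' B B' σu hσ N hg',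
    ← lintegral_add_right _ (g := fun r => ENNReal.ofReal (Real.exp (L r)) * g' r)
      (hLm.exp.ennreal_ofReal.mul hg')]
  -- Pointwise, `min(1, e^L) (g + g') ≤ g + e^L g'`.
  calc _ ≤ (∫⁻ r, ENNReal.ofReal (min 1 (Real.exp (L r))) ∂P) * c := by gcongr
    _ = ∫⁻ r, ENNReal.ofReal (min 1 (Real.exp (L r))) * c ∂P :=
      (lintegral_mul_const _ hmin).symm
    _ ≤ _ := by
      refine lintegral_mono fun r => ?_
      refine (mul_le_mul_right (hc r) _).trans ?_
      rw [mul_add]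
      refine add_le_add ?_ ?_
      · exact mul_le_of_le_one_left' (ENNReal.ofReal_le_one.2 (min_le_left _ _))
      · exact mul_le_mul_left (ENNReal.ofReal_le_ofReal (min_le_right _ _)) _

end TwoPoint

/-! ### Norm inequalities for vectors and matrices. -/

section LinearAlgebra

variable {n d : ℕ}

theorem dotProduct_add_self_le (x y : Fin n → ℝ) :
    (x + y) ⬝ᵥ (x + y) ≤ 2 * (x ⬝ᵥ x) + 2 * (y ⬝ᵥ y) := by
  have h := dotProduct_self_nonneg (x - y)
  simp only [add_dotProduct, dotProduct_add, sub_dotProduct, dotProduct_sub] at *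
  linarith

theorem vecMul_dotProduct_self {W : Matrix (Fin d) (Fin n) ℝ} (hW : W * Wᵀ = 1) (y : Fin d → ℝ) :
    (y ᵥ* W) ⬝ᵥ (y ᵥ* W) = y ⬝ᵥ y := by
  rw [← dotProduct_mulVec, ← mulVec_transpose, mulVec_mulVec, hW, one_mulVec]

/-- Bessel's inequality: the residual of the projection onto the row space has nonnegative square.
-/
theorem mulVec_dotProduct_self_le {W : Matrix (Fin d) (Fin n) ℝ} (hW : W * Wᵀ = 1)
    (v : Fin n → ℝ) : (W *ᵥ v) ⬝ᵥ (W *ᵥ v) ≤ v ⬝ᵥ v := by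
  have h := dotProduct_self_nonneg (v - (W *ᵥ v) ᵥ* W)
  have h1 := vecMul_dotProduct_self hW (W *ᵥ v)
  have h2 : (W *ᵥ v) ᵥ* W ⬝ᵥ v = (W *ᵥ v) ⬝ᵥ (W *ᵥ v) := by rw [← dotProduct_mulVec]
  have h3 := dotProduct_comm v ((W *ᵥ v) ᵥ* W)
  simp only [sub_dotProduct, dotProduct_sub] at h
  linarith

open scoped Matrix.Norms.L2Operator in
theorem vecMul_dotProduct_self_le_of_norm_le {K : Matrix (Fin d) (Fin n) ℝ} (hK : ‖K‖ ≤ 1)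
    (y : Fin d → ℝ) : (y ᵥ* K) ⬝ᵥ (y ᵥ* K) ≤ y ⬝ᵥ y := by
  have h := l2_opNorm_mulVec Kᴴ (WithLp.toLp 2 y)
  rw [l2_opNorm_conjTranspose] at h
  have h1 : ‖(WithLp.toLp 2 (y ᵥ* K) : EuclideanSpace ℝ (Fin n))‖
      ≤ ‖(WithLp.toLp 2 y : EuclideanSpace ℝ (Fin d))‖ := by
    rw [← mulVec_transpose, ← conjTranspose_eq_transpose_of_trivial]
    exact h.trans (mul_le_of_le_one_left (norm_nonneg _) hK)
  have h2 := pow_le_pow_left₀ (norm_nonneg _) h1 2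
  rw [EuclideanSpace.norm_sq_eq, EuclideanSpace.norm_sq_eq] at h2
  simpa [dotProduct, ← sq] using h2

end LinearAlgebra

/-! ### The instances: stability, information per step, excess cost. -/

section Family

variable {n d : ℕ}

/-- The state matrix `ρ Wᵀ W` of the instance with `U = Wᵀ`. -/
noncomputable def stateMatrix (ρ : ℝ) (W : Matrix (Fin d) (Fin n) ℝ) : Matrix (Fin n) (Fin n) ℝ :=
  ρ • (Wᵀ * W)

/-- The input matrix `ρ Wᵀ` of the instance with `U = Wᵀ`. -/
noncomputable def inputMatrix (ρ : ℝ) (W : Matrix (Fin d) (Fin n) ℝ) : Matrix (Fin n) (Fin d) ℝ :=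
  ρ • Wᵀ

theorem mem_instanceFamily {ρ : ℝ} {W : Matrix (Fin d) (Fin n) ℝ} (hW : W * Wᵀ = 1) :
    (stateMatrix ρ W, inputMatrix ρ W) ∈ instanceFamily n d ρ :=
  ⟨Wᵀ, by simpa using hW, by simp [stateMatrix, inputMatrix]⟩

theorem vecMul_inputMatrix (ρ : ℝ) (W : Matrix (Fin d) (Fin n) ℝ) (v : Fin n → ℝ) :
    v ᵥ* inputMatrix ρ W = ρ • (W *ᵥ v) := by
  rw [inputMatrix, vecMul_smul, vecMul_transpose]

theorem vecMul_stateMatrix (ρ : ℝ) (W : Matrix (Fin d) (Fin n) ℝ) (v : Fin n → ℝ) :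
    v ᵥ* stateMatrix ρ W = ρ • ((W *ᵥ v) ᵥ* W) := by
  rw [stateMatrix, vecMul_smul, ← vecMul_vecMul, vecMul_transpose]

open scoped Matrix.Norms.L2Operator in
theorem lintegral_sq_curState_instance_le {ρ : ℝ} (hρ0 : 0 ≤ ρ) (hρ : ρ ≤ 1 / 4)
    {W : Matrix (Fin d) (Fin n) ℝ} (hW : W * Wᵀ = 1) {K : Matrix (Fin d) (Fin n) ℝ}
    (hK : ‖K‖ ≤ 1) (σw σu : ℝ≥0) (t : ℕ) (v : Fin n → ℝ) :
    ∫⁻ h, ENNReal.ofReal ((v ⬝ᵥ curState t h) ^ 2)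
      ∂trajLaw (stateMatrix ρ W) (inputMatrix ρ W) σw (noisyFeedback n d σu) t K
      ≤ ENNReal.ofReal (2 * ((σw : ℝ) ^ 2 + (σu : ℝ) ^ 2) * (v ⬝ᵥ v)) := by
  have hρ2 : ρ ^ 2 ≤ 1 / 16 := by nlinarith
  refine lintegral_sq_curState_le _ _ σw σu (fun v => ?_) (fun v => ?_) t v
  · rw [vecMul_inputMatrix, vecMul_stateMatrix, smul_vecMul, ← smul_add, smul_dotProduct,
      dotProduct_smul, smul_eq_mul, smul_eq_mul, ← mul_assoc, ← sq]
    have h1 := dotProduct_add_self_le ((W *ᵥ v) ᵥ* W) ((W *ᵥ v) ᵥ* K)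
    have h2 := vecMul_dotProduct_self hW (W *ᵥ v)
    have h3 := vecMul_dotProduct_self_le_of_norm_le hK (W *ᵥ v)
    have h4 := mulVec_dotProduct_self_le hW v
    -- The sum of two vectors of length at most `|v|` has square at most `4 |v|²`, and `4/16 = 1/4`
    -- is the required contraction.
    have h5 := mul_le_mul hρ2 (show _ ≤ 4 * (v ⬝ᵥ v) by linarith)
      (dotProduct_self_nonneg ((W *ᵥ v) ᵥ* W + (W *ᵥ v) ᵥ* K)) (by norm_num)
    linarith
  · rw [vecMul_inputMatrix, smul_dotProduct, dotProduct_smul, smul_eq_mul, smul_eq_mul,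
      ← mul_assoc, ← sq]
    have h4 := mulVec_dotProduct_self_le hW v
    exact (mul_le_of_le_one_left (dotProduct_self_nonneg _) (by linarith)).trans h4

/-- The drift `ρ Wᵀ(Wx + u)` is a sum over the rows of `W`, so only the term of the altered row
survives. -/
theorem driftDiff_instance (ρ : ℝ) {W W' : Matrix (Fin d) (Fin n) ℝ} {k : Fin d}
    (hWW : ∀ l, l ≠ k → W' l = W l) (x : Fin n → ℝ) (u : Fin d → ℝ) :
    driftDiff (stateMatrix ρ W) (stateMatrix ρ W') (inputMatrix ρ W) (inputMatrix ρ W') x u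
      = ρ • ((W' k ⬝ᵥ x + u k) • (W' k - W k) + ((W' k - W k) ⬝ᵥ x) • W k) := by
  have e : ∀ W : Matrix (Fin d) (Fin n) ℝ, stateMatrix ρ W *ᵥ x + inputMatrix ρ W *ᵥ u
      = ρ • ((W *ᵥ x + u) ᵥ* W) := by
    intro W
    rw [stateMatrix, inputMatrix, smul_mulVec, smul_mulVec, ← smul_add, ← mulVec_mulVec,
      ← mulVec_add, mulVec_transpose]
  rw [driftDiff, e, e, ← smul_sub]
  congr 1
  ext i
  simp only [Pi.sub_apply, vecMul, dotProduct, ← Finset.sum_sub_distrib, Pi.add_apply,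
    Pi.smul_apply, smul_eq_mul]
  rw [Finset.sum_eq_single k]
  · simp only [mulVec, dotProduct, sub_mul, Finset.sum_sub_distrib]
    ring
  · intro l _ hl
    simp [mulVec, hWW l hl]
  · simp

open scoped Matrix.Norms.L2Operator in
-- Both terms of the drift difference carry one factor `W' k - W k`; what multiplies it is
-- controlled by the second moments of the state and of the input noise.
theorem meanStepVariance_instance_le {ρ : ℝ} (hρ0 : 0 ≤ ρ) (hρ : ρ ≤ 1 / 4)
    {W W' : Matrix (Fin d) (Fin n) ℝ} (hW : W * Wᵀ = 1) (hW' : W' * W'ᵀ = 1) {k : Fin d}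
    (hWW : ∀ l, l ≠ k → W' l = W l) {K : Matrix (Fin d) (Fin n) ℝ}
    (hK : ‖K‖ ≤ 1) {σw : ℝ≥0} (σu : ℝ≥0) (t : ℕ) :
    meanStepVariance (stateMatrix ρ W) (stateMatrix ρ W') (inputMatrix ρ W) (inputMatrix ρ W')
      (noisyFeedback n d σu) σw t K
      ≤ ENNReal.ofReal (24 * ρ ^ 2 * ((W' k - W k) ⬝ᵥ (W' k - W k))
          * (((σw : ℝ) ^ 2 + (σu : ℝ) ^ 2) / (σw : ℝ) ^ 2)) := by
  set δ := W' k - W k with hδ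
  set D := δ ⬝ᵥ δ with hD
  have hD0 : 0 ≤ D := dotProduct_self_nonneg δ
  have hrow : ∀ {X : Matrix (Fin d) (Fin n) ℝ}, X * Xᵀ = 1 → X k ⬝ᵥ X k = 1 := fun {X} hX => by
    have := congrFun (congrFun hX k) k
    simpa [Matrix.mul_apply, dotProduct] using this
  have hKk : K k ⬝ᵥ K k ≤ 1 := by
    have := vecMul_dotProduct_self_le_of_norm_le hK (Pi.single k 1)
    simpa [Matrix.row_def] using this
  set c₁ : ℝ := 2 * ρ ^ 2 * D / (σw : ℝ) ^ 2 with hc₁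
  set c₂ : ℝ := 2 * ρ ^ 2 / (σw : ℝ) ^ 2 with hc₂
  have hc₁0 : 0 ≤ c₁ := by positivity
  have hc₂0 : 0 ≤ c₂ := by positivity
  have hpt : ∀ x u, stepVariance (stateMatrix ρ W) (stateMatrix ρ W') (inputMatrix ρ W)
      (inputMatrix ρ W') σw x u 0
      ≤ c₁ * (W' k ⬝ᵥ x + (Pi.single k 1 : Fin d → ℝ) ⬝ᵥ u) ^ 2 + c₂ * (δ ⬝ᵥ x) ^ 2 := by
    intro x u
    rw [stepVariance, driftDiff_instance ρ hWW, ← hδ, single_dotProduct, one_mul]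
    have h := dotProduct_add_self_le ((W' k ⬝ᵥ x + u k) • δ) ((δ ⬝ᵥ x) • W k)
    simp only [smul_dotProduct, dotProduct_smul, smul_eq_mul, hrow hW, ← hD, mul_one] at h ⊢
    have h' := mul_le_mul_of_nonneg_left h (by positivity : 0 ≤ ρ ^ 2 / (σw : ℝ) ^ 2)
    refine le_trans (le_of_eq ?_) (h'.trans (le_of_eq ?_))
    · ring
    · rw [hc₁, hc₂]; ring
  have hu : ∀ h : Traj n d t, ∫⁻ u, ENNReal.ofReal (stepVariance (stateMatrix ρ W)
      (stateMatrix ρ W') (inputMatrix ρ W) (inputMatrix ρ W') σw (curState t h) u 0)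
        ∂noisyFeedback n d σu t (K, h)
      ≤ ENNReal.ofReal c₁ * ENNReal.ofReal (((W' k + K k) ⬝ᵥ curState t h) ^ 2)
        + ENNReal.ofReal c₁ * ENNReal.ofReal (σu ^ 2)
        + ENNReal.ofReal c₂ * ENNReal.ofReal ((δ ⬝ᵥ curState t h) ^ 2) := by
    intro h
    calc _ ≤ ∫⁻ u, (ENNReal.ofReal c₁ * ENNReal.ofReal ((W' k ⬝ᵥ curState t h
              + (Pi.single k 1 : Fin d → ℝ) ⬝ᵥ u) ^ 2)
            + ENNReal.ofReal c₂ * ENNReal.ofReal ((δ ⬝ᵥ curState t h) ^ 2))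
          ∂noisyFeedback n d σu t (K, h) := by
          refine lintegral_mono fun u => ?_
          rw [← ENNReal.ofReal_mul hc₁0, ← ENNReal.ofReal_mul hc₂0,
            ← ENNReal.ofReal_add (by positivity) (by positivity)]
          exact ENNReal.ofReal_le_ofReal (hpt _ _)
      _ = _ := by
          rw [lintegral_add_right _ measurable_const, lintegral_const_mul' _ _ ENNReal.ofReal_ne_top,
            lintegral_sq_noisyFeedback, mul_add]
          simp [Matrix.row_def]
  have hm : ∀ v : Fin n → ℝ, Measurable (fun h : Traj n d t =>
      ENNReal.ofReal ((v ⬝ᵥ curState t h) ^ 2)) := fun v =>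
    ((measurable_dotProduct measurable_const (measurable_curState _)).pow_const 2).ennreal_ofReal
  unfold meanStepVariance
  refine (lintegral_mono hu).trans ?_
  rw [lintegral_add_right _ ((hm δ).const_mul _), lintegral_add_right _ measurable_const,
    lintegral_const_mul _ (hm _), lintegral_const_mul _ (hm δ), lintegral_const, measure_univ,
    mul_one]
  have h1 := lintegral_sq_curState_instance_le hρ0 hρ hW hK σw σu t (W' k + K k)
  have h2 := lintegral_sq_curState_instance_le hρ0 hρ hW hK σw σu t δ
  refine (add_le_add (add_le_add_left (mul_le_mul_right h1 _) _) (mul_le_mul_right h2 _)).trans ?_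
  have hs : (W' k + K k) ⬝ᵥ (W' k + K k) ≤ 4 := by
    have := dotProduct_add_self_le (W' k) (K k)
    rw [hrow hW'] at this
    linarith
  have hs0 := dotProduct_self_nonneg (W' k + K k)
  rw [← ENNReal.ofReal_mul hc₁0, ← ENNReal.ofReal_mul hc₁0, ← ENNReal.ofReal_mul hc₂0,
    ← ENNReal.ofReal_add (by positivity) (by positivity),
    ← ENNReal.ofReal_add (by positivity) (by positivity)]
  refine ENNReal.ofReal_le_ofReal ?_
  have h3 : 2 * ((σw : ℝ) ^ 2 + (σu : ℝ) ^ 2) * ((W' k + K k) ⬝ᵥ (W' k + K k))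
      ≤ 2 * ((σw : ℝ) ^ 2 + (σu : ℝ) ^ 2) * 4 := by gcongr
  have h4 := mul_le_mul_of_nonneg_left h3 hc₁0
  have h5 : 0 ≤ c₁ * (σw : ℝ) ^ 2 := by positivity
  have h6 : 0 ≤ c₁ * (σu : ℝ) ^ 2 := by positivity
  have h7 : c₂ * D = c₁ := by rw [hc₁, hc₂]; ring
  have h8 : 24 * ρ ^ 2 * D * (((σw : ℝ) ^ 2 + (σu : ℝ) ^ 2) / (σw : ℝ) ^ 2)
      = 12 * c₁ * ((σw : ℝ) ^ 2 + (σu : ℝ) ^ 2) := by rw [hc₁]; ring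
  rw [h8, ← hD]
  have h9 : c₂ * (2 * ((σw : ℝ) ^ 2 + (σu : ℝ) ^ 2) * D)
      = 2 * c₁ * ((σw : ℝ) ^ 2 + (σu : ℝ) ^ 2) := by rw [← h7]; ring
  rw [h9]
  -- With `S = σw² + σu²`, the three contributions are at most `8`, `1` and `2` times `c₁ S`, within
  -- the allowed `12`.
  nlinarith

/-- The suboptimality of a gain is at least a multiple of its squared Frobenius distance to the
optimal gain `-W`. -/
theorem le_gainCost_sub_optCost_instance {ρ : ℝ} {W : Matrix (Fin d) (Fin n) ℝ}
    (hW : W * Wᵀ = 1) (K : Matrix (Fin d) (Fin n) ℝ) (σw : ℝ≥0) (t : ℕ) :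
    t * ENNReal.ofReal (σw ^ 2 * (ρ ^ 2 * ∑ k, (K k + W k) ⬝ᵥ (K k + W k)))
      ≤ gainCost (stateMatrix ρ W) (inputMatrix ρ W) σw (t + 1) K
        - optCost (stateMatrix ρ W) (inputMatrix ρ W) σw (t + 1) := by
  have h0 : stateMatrix ρ W + inputMatrix ρ W * (-W) = 0 := by
    simp [stateMatrix, inputMatrix]
  have htr : ∀ {l m : ℕ} (X : Matrix (Fin l) (Fin m) ℝ),
      ∑ i, X.row i ⬝ᵥ X.row i = (X * Xᵀ).trace := fun X => by
    simp [Matrix.trace, Matrix.mul_apply, dotProduct, Matrix.row]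
  have h1 : stateMatrix ρ W + inputMatrix ρ W * K = ρ • (Wᵀ * (K + W)) := by
    rw [stateMatrix, inputMatrix, Matrix.smul_mul, ← smul_add, ← Matrix.mul_add, add_comm W]
  have h2 : ∑ i, (stateMatrix ρ W + inputMatrix ρ W * K).row i
        ⬝ᵥ (stateMatrix ρ W + inputMatrix ρ W * K).row i
      = ρ ^ 2 * ∑ k, (K k + W k) ⬝ᵥ (K k + W k) := by
    rw [htr, h1]
    -- As traces, both sides agree by cyclicity and `W Wᵀ = 1`.
    have h3 : ∑ k, (K k + W k) ⬝ᵥ (K k + W k) = ((K + W) * (K + W)ᵀ).trace := by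
      rw [← htr]; rfl
    rw [h3, transpose_smul, smul_mul_smul_comm, trace_smul, transpose_mul, transpose_transpose,
      Matrix.mul_assoc, trace_mul_comm Wᵀ, Matrix.mul_assoc (K + W), Matrix.mul_assoc (K + W)ᵀ,
      hW, Matrix.mul_one, smul_eq_mul, sq]
  rw [← h2]
  exact le_gainCost_sub_optCost _ _ σw h0 K t

end Family

/-! ### Haar measure on the orthogonal group and planar reflections. -/

section Orthogonal

instance {m n : ℕ} : BorelSpace (Matrix (Fin m) (Fin n) ℝ) :=
  inferInstanceAs (BorelSpace (Fin m → Fin n → ℝ))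

instance {n : ℕ} : CompactSpace (orthogonalGroup (Fin n) ℝ) := by
  refine isCompact_iff_compactSpace.1 ?_
  have hK : IsCompact (Set.univ.pi fun _ : Fin n => Set.univ.pi fun _ : Fin n =>
      Set.Icc (-1 : ℝ) 1) :=
    isCompact_univ_pi fun _ => isCompact_univ_pi fun _ => isCompact_Icc
  refine IsCompact.of_isClosed_subset (X := Matrix (Fin n) (Fin n) ℝ) hK isClosed_unitary ?_
  intro O hO i _ j _
  have := entry_norm_bound_of_unitary hO i j
  rwa [Real.norm_eq_abs, abs_le] at this

/-- The Haar probability measure on the orthogonal group. -/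
theorem exists_invariant_measure_orthogonalGroup (n : ℕ) :
    ∃ μ : Measure (orthogonalGroup (Fin n) ℝ), IsProbabilityMeasure μ ∧
      ∀ (H : orthogonalGroup (Fin n) ℝ) (f : orthogonalGroup (Fin n) ℝ → ℝ≥0∞),
        ∫⁻ O, f (H * O) ∂μ = ∫⁻ O, f O ∂μ := by
  -- The group is compact, so Haar measure can be normalised on all of it.
  refine ⟨Measure.haarMeasure ⊤, ⟨?_⟩, fun H f => lintegral_mul_left_eq_self f H⟩
  simpa using Measure.haarMeasure_self (G := orthogonalGroup (Fin n) ℝ) (K₀ := ⊤)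

variable {n d : ℕ}

theorem orthogonalGroup_row_dotProduct_row (O : orthogonalGroup (Fin n) ℝ) (i j : Fin n) :
    O.1 i ⬝ᵥ O.1 j = if i = j then 1 else 0 := by
  have h := congrFun (congrFun ((mem_orthogonalGroup_iff (Fin n) ℝ).1 O.2) i) j
  simpa [Matrix.mul_apply, dotProduct, Matrix.one_apply, star_eq_conjTranspose] using h

/-- Parseval in the basis of the rows of `O`. -/
theorem sum_sq_row_dotProduct (O : orthogonalGroup (Fin n) ℝ) (x : Fin n → ℝ) :
    ∑ i, (O.1 i ⬝ᵥ x) ^ 2 = x ⬝ᵥ x := by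
  have h := (mem_orthogonalGroup_iff' (Fin n) ℝ).1 O.2
  have h1 : (O.1 *ᵥ x) ⬝ᵥ (O.1 *ᵥ x) = x ⬝ᵥ x := by
    rw [dotProduct_mulVec, ← mulVec_transpose, mulVec_mulVec]
    rw [show (O.1ᵀ * O.1) = 1 from h, one_mulVec]
  rw [← h1]
  simp [dotProduct, mulVec, sq]

/-- The Householder reflection `1 - v vᵀ` with `|v|² = 2`. Left multiplication by it mixes rows `p`
and `q` only; the entries `√(1-c)` and `√(1+c)` of `v` are fixed by the wanted coefficients, since
their product is `s`. -/
theorem exists_planar_reflection {p q : Fin n} (hpq : p ≠ q) {c s : ℝ} (hc : |c| ≤ 1) (hs : 0 ≤ s)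
    (hcs : c ^ 2 + s ^ 2 = 1) :
    ∃ H : orthogonalGroup (Fin n) ℝ, ∀ O : orthogonalGroup (Fin n) ℝ,
      (H * O).1 p = c • O.1 p - s • O.1 q ∧ (H * O).1 q = -(s • O.1 p) - c • O.1 q ∧
      ∀ i, i ≠ p → i ≠ q → (H * O).1 i = O.1 i := by
  obtain ⟨hc1, hc2⟩ := abs_le.1 hc
  set α := √(1 - c) with hα
  set β := √(1 + c) with hβ
  have hα2 : α * α = 1 - c := Real.mul_self_sqrt (by linarith)
  have hβ2 : β * β = 1 + c := Real.mul_self_sqrt (by linarith)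
  have hαβ : α * β = s := by
    rw [hα, hβ, ← Real.sqrt_mul (by linarith), show (1 - c) * (1 + c) = s ^ 2 by linarith,
      Real.sqrt_sq hs]
  set v : Fin n → ℝ := Pi.single p α + Pi.single q β with hv
  have hvp : v p = α := by simp [hv, hpq]
  have hvq : v q = β := by simp [hv, hpq.symm]
  have hvi : ∀ i, i ≠ p → i ≠ q → v i = 0 := fun i h1 h2 => by simp [hv, h1, h2]
  have hvv : v ⬝ᵥ v = 2 := by
    rw [hv]
    simp only [add_dotProduct, single_dotProduct, Pi.add_apply, Pi.single_eq_same,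
      Pi.single_eq_of_ne hpq, Pi.single_eq_of_ne hpq.symm]
    linarith
  have hH : (1 - vecMulVec v v) ∈ orthogonalGroup (Fin n) ℝ := by
    have hP : vecMulVec v v * vecMulVec v v = vecMulVec v v + vecMulVec v v := by
      rw [vecMulVec_mul_vecMulVec, hvv, ← two_smul ℝ (vecMulVec v v)]
      ext i j
      simp [vecMulVec_apply]
      ring
    rw [mem_orthogonalGroup_iff, transpose_sub, transpose_one, transpose_vecMulVec, mul_sub, sub_mul,
      sub_mul, hP]
    simp
  have hrow : ∀ (O : orthogonalGroup (Fin n) ℝ) i,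
      ((⟨_, hH⟩ : orthogonalGroup (Fin n) ℝ) * O).1 i
        = O.1 i - v i • (α • O.1 p + β • O.1 q) := by
    intro O i
    have h1 : v ᵥ* O.1 = α • O.1 p + β • O.1 q := by
      rw [hv, add_vecMul, single_vecMul, single_vecMul]
      rfl
    change ((1 - vecMulVec v v) * O.1) i = _
    rw [sub_mul, one_mul, vecMulVec_mul, h1]
    rfl
  refine ⟨⟨_, hH⟩, fun O => ⟨?_, ?_, fun i h1 h2 => ?_⟩⟩
  · rw [hrow, hvp, smul_add, smul_smul, smul_smul, hα2, hαβ, sub_smul, one_smul]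
    abel
  · rw [hrow, hvq, smul_add, smul_smul, smul_smul, hβ2, mul_comm β, hαβ, add_smul, one_smul]
    abel
  · rw [hrow, hvi i h1 h2, zero_smul, sub_zero]

/-- The first `d` rows of an orthogonal matrix. -/
def topRows (hdn : d ≤ n) (O : orthogonalGroup (Fin n) ℝ) : Matrix (Fin d) (Fin n) ℝ :=
  O.1.submatrix (Fin.castLE hdn) id

theorem topRows_apply (hdn : d ≤ n) (O : orthogonalGroup (Fin n) ℝ) (k : Fin d) :
    topRows hdn O k = O.1 (Fin.castLE hdn k) := rfl

theorem topRows_mul_transpose (hdn : d ≤ n) (O : orthogonalGroup (Fin n) ℝ) :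
    topRows hdn O * (topRows hdn O)ᵀ = 1 := by
  ext i j
  have h := orthogonalGroup_row_dotProduct_row O (Fin.castLE hdn i) (Fin.castLE hdn j)
  rw [Matrix.one_apply]
  simpa [Matrix.mul_apply, dotProduct, topRows] using h

theorem measurable_row (k : Fin d) : Measurable (fun K : Matrix (Fin d) (Fin n) ℝ => K k) :=
  measurable_pi_apply k

theorem measurable_topRows (hdn : d ≤ n) :
    Measurable (topRows hdn : orthogonalGroup (Fin n) ℝ → Matrix (Fin d) (Fin n) ℝ) :=
  measurable_pi_lambda _ fun k =>
    (measurable_row (Fin.castLE hdn k)).comp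
      (measurable_subtype_coe : Measurable fun O : orthogonalGroup (Fin n) ℝ => O.1)

end Orthogonal

/-! ### Splitting the loss of a row over planes. -/

section Loss

variable {n d : ℕ}

/-- The part of the loss of the row `z` that is attributed to the plane spanned by `p`, `q`. -/
noncomputable def planeLoss (m : ℝ) (z p q : Fin n → ℝ) : ℝ := (z ⬝ᵥ p + 1) ^ 2 / m + (z ⬝ᵥ q) ^ 2

theorem planeLoss_nonneg {m : ℝ} (hm : 0 ≤ m) (z p q : Fin n → ℝ) : 0 ≤ planeLoss m z p q := by
  unfold planeLoss; positivity

/-- If `z ⬝ᵥ p` is near `-1`, then `z` cannot be nearly orthogonal to both `q` and its image, as `s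
p` is a combination of these; if not, the first term of the loss pays. The trade-off `(a+1)² + a²/2`
has minimum `1/3`, at `a = -2/3`. -/
theorem le_planeLoss_add_planeLoss {m : ℝ} (hm : 1 ≤ m) {c s : ℝ} (hs : s ^ 2 = 1 / m)
    (hcs : c ^ 2 + s ^ 2 = 1) (z p q : Fin n → ℝ) :
    1 / (3 * m) ≤ planeLoss m z p q + planeLoss m z (c • p - s • q) (-(s • p) - c • q) := by
  have hm0 : 0 < m := by linarith
  simp only [planeLoss, dotProduct_sub, dotProduct_neg, dotProduct_smul, smul_eq_mul]
  generalize z ⬝ᵥ p = a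
  generalize z ⬝ᵥ q = b
  have h1 : 0 ≤ (c * a - s * b + 1) ^ 2 / m := by positivity
  -- With `y = -(s a) - c b` one has `s a = -(y + c b)`, and `c² ≤ 1`.
  have h2 : s ^ 2 * a ^ 2 / 2 ≤ b ^ 2 + (-(s * a) - c * b) ^ 2 := by
    nlinarith [sq_nonneg (s * a + 2 * (c * b)), sq_nonneg (s * b), sq_nonneg (c * b)]
  have h3 : 1 / (3 * m) ≤ (a + 1) ^ 2 / m + s ^ 2 * a ^ 2 / 2 := by
    rw [hs]
    have : (a + 1) ^ 2 / m + 1 / m * a ^ 2 / 2 - 1 / (3 * m) = (3 * a + 2) ^ 2 / (6 * m) := by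
      field_simp
      ring
    have h4 : 0 ≤ (3 * a + 2) ^ 2 / (6 * m) := by positivity
    linarith
  linarith

/-- The coordinates of `z + O.1 p` along the rows `p` and `j ∈ J` are `z ⬝ᵥ p + 1` and `z ⬝ᵥ O.1 j`.
The first is shared equally among the planes, hence the division by `J.card`; the remaining
coordinates are dropped. -/
theorem sum_planeLoss_le {J : Finset (Fin n)} (hJ : J.Nonempty) (O : orthogonalGroup (Fin n) ℝ)
    {p : Fin n} (hp : p ∉ J) (z : Fin n → ℝ) :
    ∑ j ∈ J, planeLoss (J.card) z (O.1 p) (O.1 j) ≤ (z + O.1 p) ⬝ᵥ (z + O.1 p) := by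
  have hJ0 : (J.card : ℝ) ≠ 0 := by exact_mod_cast hJ.card_pos.ne'
  rw [← sum_sq_row_dotProduct O]
  have h1 : ∑ j ∈ J, planeLoss (J.card) z (O.1 p) (O.1 j)
      = ∑ i ∈ insert p J, (O.1 i ⬝ᵥ (z + O.1 p)) ^ 2 := by
    rw [Finset.sum_insert hp]
    simp only [planeLoss, Finset.sum_add_distrib, Finset.sum_const, nsmul_eq_mul]
    congr 1
    · rw [dotProduct_add, orthogonalGroup_row_dotProduct_row, if_pos rfl, dotProduct_comm z]
      field_simp
    · refine Finset.sum_congr rfl fun j hj => ?_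
      rw [dotProduct_add, orthogonalGroup_row_dotProduct_row,
        if_neg (fun h : j = p => hp (h ▸ hj)), dotProduct_comm z, add_zero]
  rw [h1]
  exact Finset.sum_le_sum_of_subset_of_nonneg (Finset.subset_univ _) fun _ _ _ => sq_nonneg _

end Loss

/-! ### Averaging over the orthogonal group. -/

section AverageLoss

variable {n d T N : ℕ} (𝒜 : Algorithm n d T N) {σw : ℝ≥0} (σu : ℝ≥0)

/-- A change of measure to the zero system moves all dependence on the parameter into a jointly
measurable density. -/
theorem measurable_lintegral_recordLaw {Θ : Type*} [MeasurableSpace Θ]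
    {fA : Θ → Matrix (Fin n) (Fin n) ℝ} {fB : Θ → Matrix (Fin n) (Fin d) ℝ} (hA : Measurable fA)
    (hB : Measurable fB) (hσ : σw ≠ 0) {F : Θ → Record n d T N → ℝ≥0∞}
    (hF : Measurable (Function.uncurry F)) :
    Measurable (fun θ => ∫⁻ r, F θ r ∂recordLaw 𝒜 (fA θ) (fB θ) σw σu N) := by
  have e : ∀ θ, ∫⁻ r, F θ r ∂recordLaw 𝒜 (fA θ) (fB θ) σw σu N
      = ∫⁻ r, ENNReal.ofReal (Real.exp (recordSum (stepLogRatio 0 (fA θ) 0 (fB θ) σw) N r))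
          * F θ r ∂recordLaw 𝒜 0 0 σw σu N := fun θ =>
    lintegral_recordLaw_change 𝒜 0 (fA θ) 0 (fB θ) σu hσ N (hF.comp measurable_prodMk_left)
  simp_rw [e]
  have h : Measurable (fun x : Θ × Record n d T N => ENNReal.ofReal (Real.exp
      (recordSum (stepLogRatio 0 (fA x.1) 0 (fB x.1) σw) N x.2)) * F x.1 x.2) :=
    (measurable_recordSum_stepLogRatio σw measurable_const (hA.comp measurable_fst)
      measurable_const (hB.comp measurable_fst) N measurable_snd).exp.ennreal_ofReal.mul hF
  exact h.lintegral_prod_right'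

/-- The expected loss of the row `k` of the returned gain in the plane of the rows `k` and `j`. -/
noncomputable def expectedPlaneLoss (hdn : d ≤ n) (σw : ℝ≥0) (ρ m : ℝ) (k : Fin d) (j : Fin n)
    (O : orthogonalGroup (Fin n) ℝ) : ℝ≥0∞ :=
  ∫⁻ r, ∫⁻ K, ENNReal.ofReal (planeLoss m (K k) (O.1 (Fin.castLE hdn k)) (O.1 j)) ∂𝒜.output r
    ∂recordLaw 𝒜 (stateMatrix ρ (topRows hdn O)) (inputMatrix ρ (topRows hdn O)) σw σu N

theorem measurable_planeLoss (m : ℝ) {α : Type*} [MeasurableSpace α] {z p q : α → Fin n → ℝ}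
    (hz : Measurable z) (hp : Measurable p) (hq : Measurable q) :
    Measurable (fun a => ENNReal.ofReal (planeLoss m (z a) (p a) (q a))) :=
  (((((measurable_dotProduct hz hp).add_const 1).pow_const 2).div_const m).add
    ((measurable_dotProduct hz hq).pow_const 2)).ennreal_ofReal

theorem measurable_lintegral_output (k : Fin d) (i j : Fin n) (m : ℝ) :
    Measurable (fun x : orthogonalGroup (Fin n) ℝ × Record n d T N =>
      ∫⁻ K, ENNReal.ofReal (planeLoss m (K k) (x.1.1 i) (x.1.1 j)) ∂𝒜.output x.2) := by
  have := 𝒜.output_markov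
  have hO : ∀ i : Fin n, Measurable (fun x : (orthogonalGroup (Fin n) ℝ × Record n d T N) ×
      Matrix (Fin d) (Fin n) ℝ => x.1.1.1 i) := fun i =>
    (measurable_row i).comp (measurable_subtype_coe.comp (measurable_fst.comp measurable_fst))
  have h := measurable_planeLoss m ((measurable_row k).comp measurable_snd) (hO i) (hO j)
  exact h.lintegral_kernel_prod_right' (κ := 𝒜.output.comap
    (fun x : orthogonalGroup (Fin n) ℝ × Record n d T N => x.2) measurable_snd)

theorem measurable_stateMatrix (ρ : ℝ) :
    Measurable (stateMatrix ρ : Matrix (Fin d) (Fin n) ℝ → Matrix (Fin n) (Fin n) ℝ) := by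
  refine measurable_pi_lambda _ fun i => measurable_pi_lambda _ fun j => ?_
  have he : ∀ k (i : Fin n), Measurable (fun W : Matrix (Fin d) (Fin n) ℝ => W k i) := fun k i =>
    (measurable_pi_apply i).comp (measurable_row k)
  simp only [stateMatrix, Matrix.smul_apply, Matrix.mul_apply, transpose_apply]
  exact (Finset.measurable_sum _ fun k _ => (he k i).mul (he k j)).const_smul ρ

theorem measurable_inputMatrix (ρ : ℝ) :
    Measurable (inputMatrix ρ : Matrix (Fin d) (Fin n) ℝ → Matrix (Fin n) (Fin d) ℝ) :=
  measurable_pi_lambda _ fun i => measurable_pi_lambda _ fun j =>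
    (((measurable_pi_apply i).comp (measurable_row j)).const_smul ρ)

theorem measurable_expectedPlaneLoss (hdn : d ≤ n) (hσ : σw ≠ 0) (ρ m : ℝ) (k : Fin d)
    (j : Fin n) : Measurable (expectedPlaneLoss 𝒜 σu hdn σw ρ m k j) :=
  measurable_lintegral_recordLaw 𝒜 σu ((measurable_stateMatrix ρ).comp (measurable_topRows hdn))
    ((measurable_inputMatrix ρ).comp (measurable_topRows hdn)) hσ
    (measurable_lintegral_output 𝒜 k _ j m)

/-- Averaged over the Haar measure, no algorithm does well in any of the planes. -/
theorem le_lintegral_expectedPlaneLoss (hdn : d ≤ n) (hσ : σw ≠ 0) {ρ m : ℝ} (hρ0 : 0 ≤ ρ)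
    (hρ : ρ ≤ 1 / 4) (hm : 1 ≤ m)
    (hNT : N * (T * (48 * ρ ^ 2 / m * (((σw : ℝ) ^ 2 + (σu : ℝ) ^ 2) / (σw : ℝ) ^ 2))) ≤ 1 / 4)
    {k : Fin d} {j : Fin n} (hj : d ≤ j) {μ : Measure (orthogonalGroup (Fin n) ℝ)}
    [IsProbabilityMeasure μ]
    (hμ : ∀ (H : orthogonalGroup (Fin n) ℝ) (f : orthogonalGroup (Fin n) ℝ → ℝ≥0∞),
      ∫⁻ O, f (H * O) ∂μ = ∫⁻ O, f O ∂μ) :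
    ENNReal.ofReal (1 / (24 * m)) ≤ ∫⁻ O, expectedPlaneLoss 𝒜 σu hdn σw ρ m k j O ∂μ := by
  have hm0 : 0 < m := by linarith
  have := 𝒜.output_markov
  set p := Fin.castLE hdn k with hp
  have hpj : p ≠ j := fun h => by
    have := congrArg Fin.val h
    simp only [hp, Fin.val_castLE] at this
    omega
  have hm1 : 1 / m ≤ 1 := (div_le_one hm0).2 hm
  have hm1' : 0 ≤ 1 / m := by positivity
  set s := √(1 / m) with hs
  set c := √(1 - 1 / m) with hc
  have hs2 : s ^ 2 = 1 / m := Real.sq_sqrt (by positivity)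
  have hc2 : c ^ 2 = 1 - 1 / m := Real.sq_sqrt (by linarith)
  have hcs : c ^ 2 + s ^ 2 = 1 := by rw [hs2, hc2]; ring
  have hc0 : 0 ≤ c := Real.sqrt_nonneg _
  have hc1 : c ≤ 1 := by nlinarith
  obtain ⟨H, hH⟩ := exists_planar_reflection hpj (abs_le.2 ⟨by linarith, hc1⟩)
    (Real.sqrt_nonneg (1 / m)) hcs
  have hpair : ∀ O, ENNReal.ofReal (1 / 4) * ENNReal.ofReal (1 / (3 * m))
      ≤ expectedPlaneLoss 𝒜 σu hdn σw ρ m k j O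
        + expectedPlaneLoss 𝒜 σu hdn σw ρ m k j (H * O) := by
    intro O
    obtain ⟨h1, h2, h3⟩ := hH O
    refine le_lintegral_add_lintegral_recordLaw 𝒜 _ _ _ _ σu hσ
      (b := ENNReal.ofReal (48 * ρ ^ 2 / m * (((σw : ℝ) ^ 2 + (σu : ℝ) ^ 2) / (σw : ℝ) ^ 2)))
      (fun K hK t => ?_) ?_ ?_ fun r => ?_
    · refine (meanStepVariance_instance_le (k := k) hρ0 hρ (topRows_mul_transpose hdn O)
        (topRows_mul_transpose hdn (H * O)) (fun l hl => ?_) hK σu t).trans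
        (ENNReal.ofReal_le_ofReal ?_)
      · rw [topRows_apply, topRows_apply]
        refine h3 _ (fun h => hl ((Fin.castLE_injective hdn) h)) fun h => ?_
        have := congrArg Fin.val h
        simp only [Fin.val_castLE] at this
        omega
      · have hδ : topRows hdn (H * O) k - topRows hdn O k = (c - 1) • O.1 p - s • O.1 j := by
          rw [topRows_apply, topRows_apply, ← hp, h1, sub_smul, one_smul]
          abel
        have hδ2 : (topRows hdn (H * O) k - topRows hdn O k) ⬝ᵥ
            (topRows hdn (H * O) k - topRows hdn O k) ≤ 2 / m := by
          rw [hδ]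
          simp only [sub_dotProduct, dotProduct_sub, smul_dotProduct, dotProduct_smul, smul_eq_mul,
            orthogonalGroup_row_dotProduct_row, if_pos, if_neg hpj, if_neg hpj.symm]
          have : 2 / m = 2 * s ^ 2 := by rw [hs2]; ring
          rw [this]
          -- The left side is `(1-c)² + s² = 2(1-c)`, and `1 - c ≤ 1 - c² = s²` as `0 ≤ c ≤ 1`.
          nlinarith
        calc _ ≤ 24 * ρ ^ 2 * (2 / m) * (((σw : ℝ) ^ 2 + (σu : ℝ) ^ 2) / (σw : ℝ) ^ 2) := by
              gcongr
          _ = _ := by ring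
    · rw [← ENNReal.ofReal_natCast, ← ENNReal.ofReal_natCast, ← ENNReal.ofReal_mul (by positivity),
        ← ENNReal.ofReal_mul (by positivity)]
      exact ENNReal.ofReal_le_ofReal hNT
    · exact (measurable_lintegral_output 𝒜 k p j m).comp measurable_prodMk_left
    · rw [← lintegral_add_left (measurable_planeLoss m (measurable_row k) measurable_const
        measurable_const), ← hp, h1, h2]
      calc _ = ∫⁻ _, ENNReal.ofReal (1 / (3 * m)) ∂𝒜.output r := by simp
        _ ≤ _ := by
          refine lintegral_mono fun K => ?_
          rw [← ENNReal.ofReal_add (planeLoss_nonneg hm0.le _ _ _) (planeLoss_nonneg hm0.le _ _ _)]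
          exact ENNReal.ofReal_le_ofReal (le_planeLoss_add_planeLoss hm hs2 hcs _ _ _)
  have hsum : ENNReal.ofReal (1 / 4) * ENNReal.ofReal (1 / (3 * m))
      ≤ 2 * ∫⁻ O, expectedPlaneLoss 𝒜 σu hdn σw ρ m k j O ∂μ := by
    have hmeas := measurable_expectedPlaneLoss 𝒜 σu hdn hσ ρ m k j
    calc _ = ∫⁻ _, ENNReal.ofReal (1 / 4) * ENNReal.ofReal (1 / (3 * m)) ∂μ := by simp
      _ ≤ _ := lintegral_mono hpair
      -- Invariance makes the averages at `O` and `H * O` equal.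
      _ = _ := by rw [lintegral_add_left hmeas, hμ H, two_mul]
  refine (ENNReal.mul_le_mul_iff_right (a := 2) (by norm_num) (by norm_num)).1 (le_trans (le_of_eq ?_) hsum)
  rw [← ENNReal.ofReal_mul (by norm_num), show (2 : ℝ≥0∞) = ENNReal.ofReal 2 by simp,
    ← ENNReal.ofReal_mul (by norm_num)]
  congr 1
  field_simp
  norm_num

/-- The planes of one row add up to at most its squared error, and the rows to the squared Frobenius
error. The horizon is `T + 1`, so the factor `T` is the number of transitions that pay. -/
theorem mul_sum_expectedPlaneLoss_le_risk {T : ℕ} (𝒜 : Algorithm n d (T + 1) N) (hdn : d ≤ n)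
    (σw : ℝ≥0) (ρ : ℝ) {J : Finset (Fin n)} (hJ : J.Nonempty) (hJd : ∀ j ∈ J, d ≤ j.val)
    (O : orthogonalGroup (Fin n) ℝ) :
    ENNReal.ofReal (T * (σw ^ 2 * ρ ^ 2))
        * ∑ k, ∑ j ∈ J, expectedPlaneLoss 𝒜 σu hdn σw ρ J.card k j O
      ≤ risk 𝒜 (stateMatrix ρ (topRows hdn O)) (inputMatrix ρ (topRows hdn O)) σw σu := by
  have hJ0 : (0 : ℝ) ≤ J.card := by positivity
  have hml : ∀ k j, Measurable (fun r : Record n d (T + 1) N => ∫⁻ K, ENNReal.ofReal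
      (planeLoss J.card (K k) (O.1 (Fin.castLE hdn k)) (O.1 j)) ∂𝒜.output r) := fun k j =>
    (measurable_lintegral_output 𝒜 k (Fin.castLE hdn k) j J.card).comp
    (measurable_prodMk_left (x := O))
  have e : ∑ k, ∑ j ∈ J, expectedPlaneLoss 𝒜 σu hdn σw ρ J.card k j O
      = ∫⁻ r, ∫⁻ K, ∑ k, ∑ j ∈ J, ENNReal.ofReal (planeLoss J.card (K k)
          (O.1 (Fin.castLE hdn k)) (O.1 j)) ∂𝒜.output r
        ∂recordLaw 𝒜 (stateMatrix ρ (topRows hdn O)) (inputMatrix ρ (topRows hdn O)) σw σu N := by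
    have hmp : ∀ k j, Measurable (fun K : Matrix (Fin d) (Fin n) ℝ => ENNReal.ofReal
        (planeLoss J.card (K k) (O.1 (Fin.castLE hdn k)) (O.1 j))) := fun k j =>
      measurable_planeLoss _ (measurable_row k) measurable_const measurable_const
    simp_rw [lintegral_finsetSum _ fun k _ => Finset.measurable_sum J fun j _ => hmp k j]
    simp_rw [lintegral_finsetSum J fun j _ => hmp _ j]
    rw [lintegral_finsetSum _ fun k _ => Finset.measurable_sum J fun j _ => hml k j]
    refine Finset.sum_congr rfl fun k _ => ?_
    rw [lintegral_finsetSum _ fun j _ => hml k j]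
    rfl
  rw [e, ← lintegral_const_mul' _ _ ENNReal.ofReal_ne_top]
  refine lintegral_mono fun r => ?_
  rw [← lintegral_const_mul' _ _ ENNReal.ofReal_ne_top]
  refine lintegral_mono fun K => ?_
  refine le_trans ?_ (le_gainCost_sub_optCost_instance (topRows_mul_transpose hdn O) K σw T)
  have hsum : ∑ k, ∑ j ∈ J, ENNReal.ofReal (planeLoss J.card (K k) (O.1 (Fin.castLE hdn k)) (O.1 j))
      ≤ ENNReal.ofReal (∑ k, (K k + topRows hdn O k) ⬝ᵥ (K k + topRows hdn O k)) := by
    rw [ENNReal.ofReal_sum_of_nonneg fun k _ => dotProduct_self_nonneg _]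
    refine Finset.sum_le_sum fun k _ => ?_
    refine (ENNReal.ofReal_sum_of_nonneg fun j _ => planeLoss_nonneg hJ0 _ _ _).symm.trans_le ?_
    refine ENNReal.ofReal_le_ofReal (sum_planeLoss_le hJ O (fun h => ?_) (K k))
    have := hJd _ h
    simp only [Fin.val_castLE] at this
    omega
  refine (mul_le_mul_right hsum _).trans (le_of_eq ?_)
  rw [ENNReal.ofReal_mul (Nat.cast_nonneg T), ENNReal.ofReal_natCast, mul_assoc,
    ← ENNReal.ofReal_mul (by positivity), mul_assoc ((σw : ℝ) ^ 2)]

end AverageLoss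

end LQR

/-! ### Choice of `ρ` and conclusion. -/

theorem theorem6 :
    ∃ c : ℝ, 0 < c ∧ ∃ C : ℝ, 0 < C ∧
      ∀ (n d T N : ℕ) (σw σu : ℝ≥0), 1 ≤ d → 2 * d ≤ n → C < (d : ℝ) * ((n : ℝ) - d) →
        2 ≤ T → 1 ≤ N → 0 < σw →
        (σw : ℝ) ^ 2 * ((n : ℝ) - d) ≤ ((σw : ℝ) ^ 2 + (σu : ℝ) ^ 2) * (T * N) →
        ENNReal.ofReal
            (c * ((σw : ℝ) ^ 4 / ((σw : ℝ) ^ 2 + (σu : ℝ) ^ 2) * (d * ((n : ℝ) - d) / N))) ≤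
          ⨅ 𝒜 : LQR.Algorithm n d T N,
            ⨆ ρ ∈ Set.Ioo (0 : ℝ) (1 / 4), ⨆ P ∈ LQR.instanceFamily n d ρ,
              LQR.risk 𝒜 P.1 P.2 σw σu := by
  -- `9216 = 2 · 24 · 192`: the factor `T ≤ 2(T-1)`, the loss per plane, and the constant in `ρ²`.
  refine ⟨1 / 9216, by norm_num, 1, one_pos, ?_⟩
  intro n d T N σw σu hd hdn _ hT hN hσw hTN
  refine le_iInf fun 𝒜 => ?_
  obtain ⟨t, rfl⟩ : ∃ t, T = t + 1 := ⟨T - 1, by omega⟩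
  have hle : d ≤ n := by omega
  have hσ0 : (0 : ℝ) < σw := by exact_mod_cast hσw
  have hN0 : (0 : ℝ) < N := by exact_mod_cast hN
  set J : Finset (Fin n) := Finset.univ.filter fun j => d ≤ j.val with hJdef
  have hJcard : J.card = n - d := by
    have h1 : J = Finset.univ.filter fun j : Fin n => ¬ j.val < d := by simp [hJdef]
    have h2 := Finset.card_filter_add_card_filter_not (s := (Finset.univ : Finset (Fin n)))
      (fun j : Fin n => j.val < d)
    rw [← h1, Fin.card_filter_val_lt, Finset.card_univ, Fintype.card_fin, min_eq_right hle] at h2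
    omega
  have hJne : J.Nonempty := Finset.card_pos.1 (by omega)
  set m : ℝ := (J.card : ℝ) with hm
  have hmn : (n : ℝ) - d = m := by rw [hm, hJcard, Nat.cast_sub hle]
  have hm1 : 1 ≤ m := by
    rw [hm]
    exact_mod_cast hJne.card_pos
  have hm0 : 0 < m := by linarith
  rw [hmn] at hTN ⊢
  set T : ℝ := ((t + 1 : ℕ) : ℝ) with hTdef
  have hT0 : 0 < T := by positivity
  set S : ℝ := (σw : ℝ) ^ 2 + (σu : ℝ) ^ 2 with hS
  have hS0 : 0 < S := by positivity
  -- The value of `ρ²` for which the information budget `hNT` holds with equality. The lower bound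
  -- on `T N` then keeps `ρ` below `1/4`.
  set q : ℝ := m * (σw : ℝ) ^ 2 / (192 * (N * T) * S) with hq
  have hq0 : 0 < q := by positivity
  have hq1 : q ≤ 1 / 192 := by
    rw [hq, div_le_div_iff₀ (by positivity) (by norm_num)]
    linarith
  set ρ : ℝ := √q with hρ
  have hρ2 : ρ ^ 2 = q := Real.sq_sqrt hq0.le
  have hρ0 : 0 < ρ := Real.sqrt_pos.2 hq0
  have hρ1 : ρ < 1 / 4 := by nlinarith
  have hNT : N * (T * (48 * ρ ^ 2 / m * (S / (σw : ℝ) ^ 2))) ≤ 1 / 4 := by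
    rw [hρ2, hq]
    refine le_of_eq ?_
    field_simp
    norm_num
  obtain ⟨μ, hμp, hμ⟩ := LQR.exists_invariant_measure_orthogonalGroup n
  have hrisk : ∀ O, ENNReal.ofReal (t * ((σw : ℝ) ^ 2 * ρ ^ 2))
        * ∑ k, ∑ j ∈ J, LQR.expectedPlaneLoss 𝒜 σu hle σw ρ m k j O
      ≤ ⨆ ρ ∈ Set.Ioo (0 : ℝ) (1 / 4), ⨆ P ∈ LQR.instanceFamily n d ρ,
          LQR.risk 𝒜 P.1 P.2 σw σu := fun O =>
    (LQR.mul_sum_expectedPlaneLoss_le_risk σu 𝒜 hle σw ρ hJne (fun j hj => by simpa [hJdef] using hj)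
      O).trans (le_iSup₂_of_le ρ ⟨hρ0, hρ1⟩ (le_iSup₂_of_le
        (LQR.stateMatrix ρ (LQR.topRows hle O), LQR.inputMatrix ρ (LQR.topRows hle O))
        (LQR.mem_instanceFamily (LQR.topRows_mul_transpose hle O)) le_rfl))
  have hmeas := fun k j => LQR.measurable_expectedPlaneLoss 𝒜 σu hle hσw.ne' ρ m k j
  have hint := lintegral_mono (μ := μ) hrisk
  rw [lintegral_const, measure_univ, mul_one, lintegral_const_mul' _ _ ENNReal.ofReal_ne_top,
    lintegral_finsetSum _ fun k _ => Finset.measurable_sum J fun j _ => hmeas k j] at hint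
  simp_rw [lintegral_finsetSum J fun j _ => hmeas _ j] at hint
  refine le_trans ?_ hint
  calc _ ≤ ENNReal.ofReal (t * ((σw : ℝ) ^ 2 * ρ ^ 2)) *
        ∑ _k : Fin d, ∑ _j ∈ J, ENNReal.ofReal (1 / (24 * m)) := by
        simp only [Finset.sum_const, Finset.card_univ, Fintype.card_fin, nsmul_eq_mul]
        rw [← ENNReal.ofReal_natCast, ← ENNReal.ofReal_natCast, ← ENNReal.ofReal_mul (by positivity),
          ← ENNReal.ofReal_mul (by positivity), ← ENNReal.ofReal_mul (by positivity)]
        refine ENNReal.ofReal_le_ofReal ?_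
        -- Here `T ≥ 2` enters: a single transition from `x_0 = 0` would not reveal the gain in the
        -- cost.
        have ht : T ≤ 2 * t := by
          have : (1 : ℝ) ≤ t := by exact_mod_cast (by omega : 1 ≤ t)
          rw [hTdef]
          push_cast
          linarith
        rw [← hm, hρ2, hq]
        have e1 : (t : ℝ) * ((σw : ℝ) ^ 2 * (m * (σw : ℝ) ^ 2 / (192 * (N * T) * S)))
            * (d * (m * (1 / (24 * m))))
            = 2 * t / T * (1 / 9216 * ((σw : ℝ) ^ 4 / S * (d * m / N))) := by
          field_simp
          ring
        rw [e1]
        exact le_mul_of_one_le_left (by positivity) ((one_le_div hT0).2 ht)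
    _ ≤ _ := by
        refine mul_le_mul_right (Finset.sum_le_sum fun k _ => Finset.sum_le_sum fun j hj => ?_) _
        exact LQR.le_lintegral_expectedPlaneLoss 𝒜 σu hle hσw.ne' hρ0.le hρ1.le hm1 hNT
          (by simpa [hJdef] using hj) hμ
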